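/- Let $\mathcal{E}$ be a quantum process on a $d$-dimensional system, i.e. a linear map on $M_d = M_d(\mathbb{C})$ of the form $\mathcal{E}(\rho)=\sum_i K_i\rho K_i^\dagger$ (finitely many terms) with $\sum_i K_i^\dagger K_i = 1$. A *code* is an arbitrary set of density matrices in $M_d$. A code $\mathcal{C}$ is *preserved* by $\mathcal{E}$ if $\|\mathcal{E}(\rho-x\rho')\|_1=\|\rho-x\rho'\|_1$ for all $\rho,\rho'\in\mathcal{C}$ and all real $x\ge 0$, where $\|\cdot\|_1$ is the trace norm. Two sets of density matrices $\mathcal{C},\mathcal{C}'$ are *isometric* if there is a bijection $f:\mathcal{C}\to\mathcal{C}'$ with $\|f(\rho)-xf(\rho')\|_1=\|\rho-x\rho'\|_1$ for all $\rho,\rho'\in\mathcal{C}$ and $x\ge 0$. A preserved code is *optimal* if it is not isometric to a proper subset of any code preserved by $\mathcal{E}$. An *information-preserving structure* (IPS) of $\mathcal{E}$ is the geometric structure common to an equivalence class, under isometry, of optimal preserved codes. A *matrix algebra* in $M_d$ is a complex linear subspace of $M_d$ closed under products and adjoints (its unit may be a proper projection of $M_d$). Then: 1. Every optimal preserved code $\mathcal{C}$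 of $\mathcal{E}$ is isometric to a matrix algebra $\mathcal{A}\subseteq M_d$: there is a $\mathbb{C}$-linear bijection from $\operatorname{span}_{\mathbb{C}}\mathcal{C}$ onto $\mathcal{A}$ which preserves the trace norm and under which the elements of $\mathcal{C}$ correspond exactly to the density matrices in $\mathcal{A}$. 2. Every IPS of $\mathcal{E}$ is a subalgebra of $M_d$: for every isometry class of optimal preserved codes of $\mathcal{E}$ there is one matrix algebra $\mathcal{A}\subseteq M_d$ such that every code in the class is isometric to the set of density matrices in $\mathcal{A}$. -/

import Mathlib

open scoped Matrix ComplexOrder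

/-- The trace norm `‖X‖₁ = Tr √(X† X)`: the sum of the singular values of `X`. -/
noncomputable def traceNorm {d : ℕ} (X : Matrix (Fin d) (Fin d) ℂ) : ℝ :=
  ∑ i, Real.sqrt ((Matrix.isHermitian_conjTranspose_mul_self X).eigenvalues i)

/-- The states of a `d`-dimensional system: non-negative matrices of trace one. -/
def densityMatrices (d : ℕ) : Set (Matrix (Fin d) (Fin d) ℂ) :=
  {ρ | ρ.PosSemidef ∧ ρ.trace = 1}

/-- A quantum process (channel): a linear, completely positive, trace-preserving map, that is,
a map with a Kraus representation `ρ ↦ ∑ i, K i ρ (K i)†` where `∑ i, (K i)† K i = 1`. -/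
def IsQuantumProcess {d : ℕ}
    (E : Matrix (Fin d) (Fin d) ℂ →ₗ[ℂ] Matrix (Fin d) (Fin d) ℂ) : Prop :=
  ∃ (n : ℕ) (K : Fin n → Matrix (Fin d) (Fin d) ℂ),
    (∀ ρ, E ρ = ∑ i, K i * ρ * (K i)ᴴ) ∧ ∑ i, (K i)ᴴ * K i = 1

/-- A code is an arbitrary set of states. It is preserved by `E` if every pair of states in it
is exactly as distinguishable after `E` as before, for all prior weights. -/
def IsPreservedCode {d : ℕ}
    (E : Matrix (Fin d) (Fin d) ℂ →ₗ[ℂ] Matrix (Fin d) (Fin d) ℂ)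
    (C : Set (Matrix (Fin d) (Fin d) ℂ)) : Prop :=
  C ⊆ densityMatrices d ∧
    ∀ ρ ∈ C, ∀ ρ' ∈ C, ∀ x : ℝ, 0 ≤ x →
      traceNorm (E (ρ - (x : ℂ) • ρ')) = traceNorm (ρ - (x : ℂ) • ρ')

/-- Two sets of states are isometric if there is a bijection between them under which every pair
of states keeps its distinguishability, for all prior weights. (No linearity is required.) -/
def IsometricCodes {d : ℕ} (C C' : Set (Matrix (Fin d) (Fin d) ℂ)) : Prop :=
  ∃ f : Matrix (Fin d) (Fin d) ℂ → Matrix (Fin d) (Fin d) ℂ, Set.BijOn f C C' ∧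
    ∀ ρ ∈ C, ∀ ρ' ∈ C, ∀ x : ℝ, 0 ≤ x →
      traceNorm (f ρ - (x : ℂ) • f ρ') = traceNorm (ρ - (x : ℂ) • ρ')

/-- An optimal preserved code encodes as many states as possible: it is preserved, and it is not
isometric to a proper subset of any preserved code. -/
def IsOptimalPreservedCode {d : ℕ}
    (E : Matrix (Fin d) (Fin d) ℂ →ₗ[ℂ] Matrix (Fin d) (Fin d) ℂ)
    (C : Set (Matrix (Fin d) (Fin d) ℂ)) : Prop :=
  IsPreservedCode E C ∧
    ∀ C' S : Set (Matrix (Fin d) (Fin d) ℂ),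
      IsPreservedCode E C' → S ⊂ C' → ¬ IsometricCodes C S

/-- An information-preserving structure of `E`, given as an isometry class of optimal preserved
codes. -/
def IsIPS {d : ℕ}
    (E : Matrix (Fin d) (Fin d) ℂ →ₗ[ℂ] Matrix (Fin d) (Fin d) ℂ)
    (I : Set (Set (Matrix (Fin d) (Fin d) ℂ))) : Prop :=
  ∃ C₀, IsOptimalPreservedCode E C₀ ∧
    I = {C | IsOptimalPreservedCode E C ∧ IsometricCodes C C₀}

/-- The states contained in a matrix algebra `A ⊆ M_d`. A matrix algebra is closed under the
adjoint, and its unit may be a proper projection of `M_d`. -/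
def algebraStates {d : ℕ} (A : NonUnitalStarSubalgebra ℂ (Matrix (Fin d) (Fin d) ℂ)) :
    Set (Matrix (Fin d) (Fin d) ℂ) :=
  {ρ | ρ ∈ A ∧ ρ ∈ densityMatrices d}

/-- The code `C` is isometric to the matrix algebra `A`: there is a linear, trace-norm-preserving
bijection from the operator space spanned by `C` onto `A` under which the elements of `C`
correspond exactly to the states in `A`. -/
def IsometricToAlgebra {d : ℕ} (C : Set (Matrix (Fin d) (Fin d) ℂ))
    (A : NonUnitalStarSubalgebra ℂ (Matrix (Fin d) (Fin d) ℂ)) : Prop :=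
  ∃ Φ : Submodule.span ℂ C ≃ₗ[ℂ] A,
    (∀ X : Submodule.span ℂ C,
      traceNorm (Φ X : Matrix (Fin d) (Fin d) ℂ) = traceNorm (X : Matrix (Fin d) (Fin d) ℂ)) ∧
    ∀ X : Submodule.span ℂ C,
      (X : Matrix (Fin d) (Fin d) ℂ) ∈ C ↔ (Φ X : Matrix (Fin d) (Fin d) ℂ) ∈ algebraStates A

/-! Everything rests on the Helstrom description of the trace norm: for Hermitian `X`, `‖X‖₁` is the
maximum of `2 Tr(XS) - Tr X` over tests `0 ≤ S ≤ 1`, attained at the spectral projection `posProj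
X`. If a code is preserved, the optimal test on the outputs, pulled back by the dual of `E`, is an
optimal test on the inputs.

Optimality fixes the pulled-back test `T` only on the support of `X = ρ - xσ`. The rest of the
code's support `p` is controlled by letting `x → 0`: the first-order term of `‖ρ - xσ‖₁` is governed
by the weight of `σ` on the support of `ρ`, so these weights cannot be lost either
(`trace_mul_suppProj_le`, `kraus_mul_sub_suppProj`). For all but finitely many `x` this forces `T p
= posProj X`, and then the output projection intertwines with `posProj X` through every Kraus
operator (`posProj_mul_kraus`).

Operators on the range of `p` intertwined in this way form a *-algebra `M`, and `E` is isometric on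
its Hermitian part (`traceNorm_kraus_of_mem`), so the states of `M` are themselves a preserved code.
Let `F` be the trace-preserving projection onto `M`. Since the optimal tests lie in `M`, `F` keeps
all distances within the code, first for generic `x` and then by continuity. An optimal code must
therefore be mapped by `F` onto all states of `M`.

It remains to make the isometry linear. A code mapped by `F` onto all states of `M` has the form `{m
t}`, where `t ≥ 0` is a fixed operator commuting with `M` and `F t = p` (`exists_commutant`).
Multiplication by such a `t` preserves the trace norm on all of `M`
(`IsTraceExpectation.traceNorm_mul`), so `F` restricted to the span of the code is the required map,
with inverse `m ↦ m t`. -/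

/-! ### Functional calculus for Hermitian matrices. -/

open scoped MatrixOrder in
theorem posSemidef_cfc {d : ℕ} {A : Matrix (Fin d) (Fin d) ℂ} {f : ℝ → ℝ}
    (hf : ∀ x ∈ spectrum ℝ A, 0 ≤ f x) : (cfc f A).PosSemidef :=
  Matrix.nonneg_iff_posSemidef.1 (cfc_nonneg hf)

theorem continuousOn_spectrum {d : ℕ} (A : Matrix (Fin d) (Fin d) ℂ) (f : ℝ → ℝ) :
    ContinuousOn f (spectrum ℝ A) :=
  (Matrix.finite_real_spectrum (A := A)).continuousOn f

theorem cfc_mul_cfc {d : ℕ} (A : Matrix (Fin d) (Fin d) ℂ) (f g : ℝ → ℝ) :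
    cfc f A * cfc g A = cfc (fun x => f x * g x) A :=
  (cfc_mul f g A (continuousOn_spectrum A f) (continuousOn_spectrum A g)).symm

theorem cfc_add_cfc {d : ℕ} (A : Matrix (Fin d) (Fin d) ℂ) (f g : ℝ → ℝ) :
    cfc f A + cfc g A = cfc (fun x => f x + g x) A :=
  (cfc_add (a := A) f g (continuousOn_spectrum A f) (continuousOn_spectrum A g)).symm

theorem cfc_sub_cfc {d : ℕ} (A : Matrix (Fin d) (Fin d) ℂ) (f g : ℝ → ℝ) :
    cfc f A - cfc g A = cfc (fun x => f x - g x) A :=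
  (cfc_sub (a := A) f g (continuousOn_spectrum A f) (continuousOn_spectrum A g)).symm

theorem isHermitian_cfc {d : ℕ} (A : Matrix (Fin d) (Fin d) ℂ) (f : ℝ → ℝ) :
    (cfc f A).IsHermitian := cfc_predicate f A

theorem cfc_self {d : ℕ} {A : Matrix (Fin d) (Fin d) ℂ} (hA : A.IsHermitian) :
    cfc (fun x : ℝ => x) A = A := cfc_id' ℝ A hA

theorem cfc_mul_self_left {d : ℕ} {A : Matrix (Fin d) (Fin d) ℂ} (hA : A.IsHermitian)
    (f : ℝ → ℝ) : cfc f A * A = cfc (fun x => f x * x) A := by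
  conv_lhs => rhs; rw [← cfc_self hA]
  rw [cfc_mul_cfc]

theorem cfc_mul_self_right {d : ℕ} {A : Matrix (Fin d) (Fin d) ℂ} (hA : A.IsHermitian)
    (f : ℝ → ℝ) : A * cfc f A = cfc (fun x => x * f x) A := by
  conv_lhs => lhs; rw [← cfc_self hA]
  rw [cfc_mul_cfc]

theorem trace_cfc {d : ℕ} {A : Matrix (Fin d) (Fin d) ℂ} (hA : A.IsHermitian) (f : ℝ → ℝ) :
    (cfc f A).trace = ∑ i, (f (hA.eigenvalues i) : ℂ) := by
  rw [hA.cfc_eq, Matrix.IsHermitian.cfc, Unitary.conjStarAlgAut_apply, Matrix.trace_mul_cycle]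
  simp [Matrix.trace]

/-- The functional calculus of an element of a matrix algebra stays in the algebra. -/
theorem cfc_mem_algebra {d : ℕ} (M : NonUnitalStarSubalgebra ℂ (Matrix (Fin d) (Fin d) ℂ))
    {A : Matrix (Fin d) (Fin d) ℂ} (hA : A.IsHermitian) (hM : A ∈ M) {f : ℝ → ℝ}
    (hf : f 0 = 0) : cfc f A ∈ M := by
  classical
  -- The node `0` forces the interpolant to have no constant term: the algebra need not contain `1`.
  set s : Finset ℝ := insert 0 (Matrix.finite_real_spectrum (A := A)).toFinset with hs
  set q : Polynomial ℝ := Lagrange.interpolate s id f with hq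
  have hev : ∀ x ∈ s, q.eval x = f x := fun x hx =>
    Lagrange.eval_interpolate_at_node f (Set.injOn_id _) hx
  have h1 : cfc f A = Polynomial.aeval A q := by
    rw [← cfc_polynomial (R := ℝ) q A hA]
    exact cfc_congr fun x hx => (hev x (by simp [hs, hx])).symm
  have h0 : q.coeff 0 = 0 := by
    rw [Polynomial.coeff_zero_eq_eval_zero, hev 0 (by simp [hs]), hf]
  have h2 : q = Polynomial.X * q.divX := by
    conv_lhs => rw [← Polynomial.X_mul_divX_add q, h0]
    simp
  have key : ∀ r : Polynomial ℝ, A * Polynomial.aeval A r ∈ M := by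
    intro r
    induction r using Polynomial.induction_on with
    | C a =>
      have : A * Polynomial.aeval A (Polynomial.C a) = (a : ℂ) • A := by
        simp [Algebra.algebraMap_eq_smul_one]
      rw [this]
      exact SMulMemClass.smul_mem _ hM
    | add p q hp hq => rw [map_add, mul_add]; exact add_mem hp hq
    | monomial n a ih =>
      have : A * Polynomial.aeval A (Polynomial.C a * Polynomial.X ^ (n + 1)) =
          (A * Polynomial.aeval A (Polynomial.C a * Polynomial.X ^ n)) * A := by
        simp [pow_succ, mul_assoc]
      rw [this]
      exact mul_mem ih hM
  rw [h1, h2, map_mul, Polynomial.aeval_X]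
  exact key _

/-! ### Support projections, positive and negative parts. -/

/-- The projection onto the range of a Hermitian matrix. -/
noncomputable def suppProj {d : ℕ} (A : Matrix (Fin d) (Fin d) ℂ) : Matrix (Fin d) (Fin d) ℂ :=
  cfc (fun x : ℝ => if x = 0 then 0 else 1) A

/-- The spectral projection of a Hermitian matrix for the positive eigenvalues. -/
noncomputable def posProj {d : ℕ} (A : Matrix (Fin d) (Fin d) ℂ) : Matrix (Fin d) (Fin d) ℂ :=
  cfc (fun x : ℝ => if 0 < x then 1 else 0) A

/-- The positive part of a Hermitian matrix. -/
noncomputable def posPt {d : ℕ} (A : Matrix (Fin d) (Fin d) ℂ) : Matrix (Fin d) (Fin d) ℂ :=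
  cfc (fun x : ℝ => max x 0) A

/-- The negative part of a Hermitian matrix. -/
noncomputable def negPt {d : ℕ} (A : Matrix (Fin d) (Fin d) ℂ) : Matrix (Fin d) (Fin d) ℂ :=
  cfc (fun x : ℝ => max (-x) 0) A

section parts

variable {d : ℕ} {A : Matrix (Fin d) (Fin d) ℂ}

theorem posPt_posSemidef : (posPt A).PosSemidef := posSemidef_cfc fun _ _ => le_max_right _ _

theorem negPt_posSemidef : (negPt A).PosSemidef := posSemidef_cfc fun _ _ => le_max_right _ _

theorem posPt_sub_negPt (hA : A.IsHermitian) : posPt A - negPt A = A := by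
  conv_rhs => rw [← cfc_self hA]
  rw [posPt, negPt, cfc_sub_cfc]
  congr 1; ext x
  rcases le_total x 0 with h | h <;> simp [h]

theorem posPt_mul_negPt : posPt A * negPt A = 0 := by
  rw [posPt, negPt, cfc_mul_cfc, ← cfc_const_zero ℝ A]
  congr 1; ext x
  rcases le_total x 0 with h | h <;> simp [h]

theorem suppProj_isHermitian : (suppProj A).IsHermitian := isHermitian_cfc _ _

theorem posProj_isHermitian : (posProj A).IsHermitian := isHermitian_cfc _ _

theorem suppProj_mul_self : suppProj A * suppProj A = suppProj A := by
  rw [suppProj, cfc_mul_cfc]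
  congr 1; ext x; split_ifs <;> simp

theorem posProj_mul_self : posProj A * posProj A = posProj A := by
  rw [posProj, cfc_mul_cfc]
  congr 1; ext x; split_ifs <;> simp

theorem suppProj_mul (hA : A.IsHermitian) : suppProj A * A = A := by
  conv_rhs => rw [← cfc_self hA]
  rw [suppProj, cfc_mul_self_left hA]
  congr 1; ext x; split_ifs with h <;> simp [h]

theorem mul_suppProj (hA : A.IsHermitian) : A * suppProj A = A := by
  conv_rhs => rw [← cfc_self hA]
  rw [suppProj, cfc_mul_self_right hA]
  congr 1; ext x; split_ifs with h <;> simp [h]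

theorem posProj_mul (hA : A.IsHermitian) : posProj A * A = posPt A := by
  rw [posProj, posPt, cfc_mul_self_left hA]
  congr 1; ext x; split_ifs with h
  · simp [h.le]
  · simp [not_lt.1 h]

theorem suppProj_eq_mul (hA : A.IsHermitian) : ∃ Z, suppProj A = Z * A := by
  refine ⟨cfc (fun x : ℝ => x⁻¹) A, ?_⟩
  rw [suppProj, cfc_mul_self_left hA]
  congr 1; ext x; split_ifs with h <;> simp [h]

theorem posProj_eq_mul (hA : A.IsHermitian) : ∃ Z, posProj A = Z * A := by
  refine ⟨cfc (fun x : ℝ => if 0 < x then x⁻¹ else 0) A, ?_⟩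
  rw [posProj, cfc_mul_self_left hA]
  congr 1; ext x; split_ifs with h
  · simp [h.ne']
  · simp

theorem posProj_eq_posPt_mul : ∃ Z, posProj A = posPt A * Z := by
  refine ⟨cfc (fun x : ℝ => x⁻¹) A, ?_⟩
  rw [posProj, posPt, cfc_mul_cfc]
  congr 1; ext x; split_ifs with h
  · simp [h.le, h.ne']
  · simp [not_lt.1 h]

theorem suppProj_eq_posProj_add : ∃ Z, suppProj A = posProj A + negPt A * Z := by
  refine ⟨cfc (fun x : ℝ => (-x)⁻¹) A, ?_⟩
  rw [posProj, negPt, suppProj, cfc_mul_cfc, cfc_add_cfc]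
  congr 1; ext x
  rcases lt_trichotomy x 0 with h | h | h
  · simp [h.le, h.ne, h.not_gt]
  · simp [h]
  · simp [h.le, h.ne', h]

/-- A nonnegative matrix dominates a positive multiple of its support projection. -/
theorem exists_smul_suppProj_le (hA : A.PosSemidef) :
    ∃ c : ℝ, 0 < c ∧ (A - (c : ℂ) • suppProj A).PosSemidef := by
  obtain ⟨c, hc, h⟩ : ∃ c : ℝ, 0 < c ∧ ∀ x ∈ spectrum ℝ A, x ≠ 0 → c ≤ |x| := by
    have hfin : (spectrum ℝ A \ {0}).Finite := (Matrix.finite_real_spectrum (A := A)).sdiff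
    rcases (spectrum ℝ A \ {0}).eq_empty_or_nonempty with he | hne
    · refine ⟨1, one_pos, fun x hx h0 => ?_⟩
      have : x ∈ spectrum ℝ A \ {0} := ⟨hx, h0⟩
      simp [he] at this
    · obtain ⟨a, ha, hmin⟩ := hfin.exists_minimalFor (fun x => |x|) _ hne
      refine ⟨|a|, abs_pos.2 ha.2, fun x hx h0 => ?_⟩
      rcases le_total |a| |x| with h | h
      · exact h
      · exact hmin ⟨hx, h0⟩ h
  refine ⟨c, hc, ?_⟩
  have h1 : (c : ℂ) • suppProj A = cfc (fun x : ℝ => c * if x = 0 then 0 else 1) A := by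
    rw [cfc_const_mul c _ A (continuousOn_spectrum A _), suppProj]
    ext i j; simp
  have h2 : A - (c : ℂ) • suppProj A = cfc (fun x : ℝ => x - c * if x = 0 then 0 else 1) A := by
    rw [h1]
    conv_lhs => lhs; rw [← cfc_self hA.1]
    rw [cfc_sub_cfc]
  rw [h2]
  refine posSemidef_cfc fun x hx => ?_
  have hx0 : 0 ≤ x := by
    simpa using (Matrix.posSemidef_iff_isHermitian_and_spectrum_nonneg.1 hA).2 hx
  split_ifs with h'
  · simp [h']
  · have := h x hx h'
    rw [abs_of_nonneg hx0] at this
    linarith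

end parts

/-! ### Traces of products of nonnegative matrices. -/

section trace

variable {d : ℕ} {A B S : Matrix (Fin d) (Fin d) ℂ}

theorem trace_re_nonneg (hA : A.PosSemidef) : 0 ≤ A.trace.re :=
  (Complex.nonneg_iff.1 hA.trace_nonneg).1

theorem trace_ofReal_smul_re (x : ℝ) (A : Matrix (Fin d) (Fin d) ℂ) :
    ((x : ℂ) • A).trace.re = x * A.trace.re := by
  simp [Matrix.trace_smul]

open scoped MatrixOrder in
theorem exists_conjTranspose_mul_self (hA : A.PosSemidef) :
    ∃ B : Matrix (Fin d) (Fin d) ℂ, A = Bᴴ * B := by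
  obtain ⟨B, hB⟩ := CStarAlgebra.nonneg_iff_eq_star_mul_self.1 (Matrix.nonneg_iff_posSemidef.2 hA)
  exact ⟨B, hB⟩

theorem posSemidef_eq_zero_of_trace (hA : A.PosSemidef) (h : A.trace.re = 0) : A = 0 := by
  obtain ⟨M, rfl⟩ := exists_conjTranspose_mul_self hA
  have him : (Mᴴ * M).trace.im = 0 := ((Complex.nonneg_iff.1 hA.trace_nonneg).2).symm
  have h0 : (Mᴴ * M).trace = 0 := Complex.ext h him
  rw [Matrix.trace_conjTranspose_mul_self_eq_zero_iff.1 h0, mul_zero]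

theorem trace_mul_re_nonneg (hA : A.PosSemidef) (hB : B.PosSemidef) : 0 ≤ (A * B).trace.re := by
  obtain ⟨M, rfl⟩ := exists_conjTranspose_mul_self hA
  rw [mul_assoc, Matrix.trace_mul_comm]
  exact trace_re_nonneg (hB.mul_mul_conjTranspose_same M)

theorem conj_eq_zero {M : Matrix (Fin d) (Fin d) ℂ} (hB : B.PosSemidef) (h : Mᴴ * B * M = 0) :
    B * M = 0 := by
  obtain ⟨N, rfl⟩ := exists_conjTranspose_mul_self hB
  have : (N * M)ᴴ * (N * M) = 0 := by
    rw [Matrix.conjTranspose_mul, ← h]; simp only [mul_assoc]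
  rw [mul_assoc, Matrix.conjTranspose_mul_self_eq_zero.1 this, mul_zero]

/-- With `A = M† M`, the trace is that of the nonnegative matrix `M B M†`. This turns equality in
trace inequalities into operator identities. -/
theorem mul_eq_zero_of_trace (hA : A.PosSemidef) (hB : B.PosSemidef) (h : (A * B).trace.re = 0) :
    A * B = 0 := by
  obtain ⟨M, rfl⟩ := exists_conjTranspose_mul_self hA
  rw [mul_assoc, Matrix.trace_mul_comm] at h
  have h1 := posSemidef_eq_zero_of_trace (hB.mul_mul_conjTranspose_same M) h
  have h2 : B * Mᴴ = 0 := conj_eq_zero hB (by simpa using h1)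
  have h3 : M * B = 0 := by
    have := congrArg Matrix.conjTranspose h2
    simpa [Matrix.conjTranspose_mul, hB.1.eq] using this
  rw [mul_assoc, h3, mul_zero]

theorem posSemidef_of_isHermitian_mul_self (hA : A.IsHermitian) (h : A * A = A) :
    A.PosSemidef := by
  have := Matrix.posSemidef_conjTranspose_mul_self A
  rwa [hA.eq, h] at this

theorem posSemidef_one_sub (hA : A.IsHermitian) (h : A * A = A) : (1 - A).PosSemidef := by
  refine posSemidef_of_isHermitian_mul_self (Matrix.isHermitian_one.sub hA) ?_
  simp only [sub_mul, mul_sub, one_mul, mul_one, h]; abel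

theorem posSemidef_ofReal_smul {x : ℝ} (hx : 0 ≤ x) (hA : A.PosSemidef) :
    ((x : ℂ) • A).PosSemidef := hA.smul (Complex.zero_le_real.2 hx)

theorem isHermitian_ofReal_smul (x : ℝ) (hA : A.IsHermitian) : ((x : ℂ) • A).IsHermitian := by
  rw [Matrix.IsHermitian, Matrix.conjTranspose_smul, hA.eq]; simp

end trace

/-! ### The trace norm and optimal two-outcome tests. -/

section traceNorm

variable {d : ℕ} {A B S : Matrix (Fin d) (Fin d) ℂ}

theorem cfc_sqrt_mul_self (hB : B.PosSemidef) : cfc Real.sqrt (B * B) = B := by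
  have h1 : B * B = cfc (fun x : ℝ => x * x) B := by
    rw [← cfc_mul_cfc B (fun x => x) (fun x => x), cfc_self hB.1]
  rw [h1, ← cfc_comp' Real.sqrt (fun x : ℝ => x * x) B
    (((Matrix.finite_real_spectrum (A := B)).image _).continuousOn _)
    (continuousOn_spectrum B _) (show IsSelfAdjoint B from hB.1)]
  conv_rhs => rw [← cfc_self hB.1]
  refine cfc_congr fun x hx => ?_
  have hx0 : 0 ≤ x := by
    simpa using (Matrix.posSemidef_iff_isHermitian_and_spectrum_nonneg.1 hB).2 hx
  exact Real.sqrt_mul_self hx0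

/-- The trace norm of `X` is the trace of any nonnegative square root of `X† X`. -/
theorem traceNorm_eq_trace {X : Matrix (Fin d) (Fin d) ℂ} (hB : B.PosSemidef)
    (h : B * B = Xᴴ * X) : traceNorm X = B.trace.re := by
  have h1 := trace_cfc (Matrix.isHermitian_conjTranspose_mul_self X) Real.sqrt
  have h2 : cfc Real.sqrt (Xᴴ * X) = B := by rw [← h, cfc_sqrt_mul_self hB]
  rw [h2] at h1
  rw [h1, traceNorm]
  simp [← Complex.ofReal_sum]

/-- Orthogonality kills the cross terms, so `A + B` is the nonnegative square root of `(A - B)†(A -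
B)`. -/
theorem traceNorm_eq_of_mul_eq_zero (hA : A.PosSemidef) (hB : B.PosSemidef) (h : A * B = 0) :
    traceNorm (A - B) = A.trace.re + B.trace.re := by
  have h' : B * A = 0 := by
    have := congrArg Matrix.conjTranspose h
    simpa [Matrix.conjTranspose_mul, hA.1.eq, hB.1.eq] using this
  rw [traceNorm_eq_trace (hA.add hB), Matrix.trace_add, Complex.add_re]
  rw [(hA.1.sub hB.1).eq]
  simp only [add_mul, mul_add, sub_mul, mul_sub, h, h']; abel

theorem traceNorm_of_posSemidef (hA : A.PosSemidef) : traceNorm A = A.trace.re :=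
  traceNorm_eq_trace hA (by rw [hA.1.eq])

theorem traceNorm_isHermitian (hA : A.IsHermitian) :
    traceNorm A = (posPt A).trace.re + (negPt A).trace.re := by
  conv_lhs => rw [← posPt_sub_negPt hA]
  exact traceNorm_eq_of_mul_eq_zero posPt_posSemidef negPt_posSemidef posPt_mul_negPt

theorem trace_posPt_sub (hA : A.IsHermitian) :
    (posPt A).trace.re - (negPt A).trace.re = A.trace.re := by
  rw [← Complex.sub_re, ← Matrix.trace_sub, posPt_sub_negPt hA]

theorem traceNorm_eq_two_mul (hA : A.IsHermitian) :
    traceNorm A = 2 * (A * posProj A).trace.re - A.trace.re := by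
  rw [Matrix.trace_mul_comm, posProj_mul hA, traceNorm_isHermitian hA, ← trace_posPt_sub hA]
  ring

/-- The trace norm bounds the bias of every two-outcome measurement. -/
theorem two_mul_trace_le_traceNorm (hA : A.IsHermitian) (hS : S.PosSemidef)
    (hS' : (1 - S).PosSemidef) : 2 * (A * S).trace.re - A.trace.re ≤ traceNorm A := by
  have h1 := trace_mul_re_nonneg (posPt_posSemidef (A := A)) hS'
  have h2 := trace_mul_re_nonneg (negPt_posSemidef (A := A)) hS
  have h3 : (A * S).trace.re = (posPt A * S).trace.re - (negPt A * S).trace.re := by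
    rw [← Complex.sub_re, ← Matrix.trace_sub, ← sub_mul, posPt_sub_negPt hA]
  rw [mul_sub, mul_one, Matrix.trace_sub, Complex.sub_re] at h1
  have h4 := trace_posPt_sub hA
  have h5 := traceNorm_isHermitian hA
  linarith

theorem traceNorm_sub_le (hA : A.PosSemidef) (hB : B.PosSemidef) :
    traceNorm (A - B) ≤ A.trace.re + B.trace.re := by
  have hS := posProj_isHermitian (A := A - B)
  have hS2 := posProj_mul_self (A := A - B)
  have h1 := trace_mul_re_nonneg hA (posSemidef_one_sub hS hS2)
  have h2 := trace_mul_re_nonneg hB (posSemidef_of_isHermitian_mul_self hS hS2)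
  rw [traceNorm_eq_two_mul (hA.1.sub hB.1), sub_mul, Matrix.trace_sub, Matrix.trace_sub]
  rw [mul_sub, mul_one, Matrix.trace_sub, Complex.sub_re] at h1
  simp only [Complex.sub_re]
  linarith

theorem traceNorm_add_le (hA : A.IsHermitian) (hB : B.IsHermitian) :
    traceNorm (A + B) ≤ traceNorm A + traceNorm B := by
  have h : A + B = (posPt A + posPt B) - (negPt A + negPt B) := by
    conv_lhs => rw [← posPt_sub_negPt hA, ← posPt_sub_negPt hB]
    abel
  rw [h, traceNorm_isHermitian hA, traceNorm_isHermitian hB]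
  refine (traceNorm_sub_le (posPt_posSemidef.add posPt_posSemidef)
    (negPt_posSemidef.add negPt_posSemidef)).trans_eq ?_
  simp only [Matrix.trace_add, Complex.add_re]; ring

/-- The trace norm exceeds the trace by twice the trace of the negative part. Positivity is thus
visible to isometries that keep traces. -/
theorem posSemidef_of_traceNorm_eq (hA : A.IsHermitian) (h : traceNorm A = A.trace.re) :
    A.PosSemidef := by
  have h1 := traceNorm_isHermitian hA
  have h2 := trace_posPt_sub hA
  have h3 : negPt A = 0 := posSemidef_eq_zero_of_trace negPt_posSemidef (by linarith)
  have h4 := posPt_sub_negPt hA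
  rw [h3, sub_zero] at h4
  rw [← h4]; exact posPt_posSemidef

theorem eq_zero_of_traceNorm (hA : A.IsHermitian) (h : traceNorm A = 0) : A = 0 := by
  have h1 := traceNorm_isHermitian hA
  have h2 := trace_re_nonneg (posPt_posSemidef (A := A))
  have h3 := trace_re_nonneg (negPt_posSemidef (A := A))
  rw [← posPt_sub_negPt hA, posSemidef_eq_zero_of_trace (posPt_posSemidef (A := A)) (by linarith),
    posSemidef_eq_zero_of_trace (negPt_posSemidef (A := A)) (by linarith), sub_zero]

theorem abs_traceNorm_sub_le (hA : A.IsHermitian) (hB : B.PosSemidef) (x y : ℝ) :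
    |traceNorm (A - (x : ℂ) • B) - traceNorm (A - (y : ℂ) • B)| ≤ B.trace.re * |x - y| := by
  have key : ∀ x y : ℝ, traceNorm (A - (x : ℂ) • B) - traceNorm (A - (y : ℂ) • B) ≤
      B.trace.re * |x - y| := by
    intro x y
    have h1 : A - (x : ℂ) • B = (A - (y : ℂ) • B) + ((y - x : ℝ) : ℂ) • B := by
      push_cast; rw [sub_smul]; abel
    have h2 := traceNorm_add_le (hA.sub (isHermitian_ofReal_smul y hB.1))
      (isHermitian_ofReal_smul (y - x) hB.1)
    rw [← h1] at h2
    have h3 : traceNorm (((y - x : ℝ) : ℂ) • B) ≤ B.trace.re * |x - y| := by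
      rcases le_total x y with h | h
      · rw [traceNorm_of_posSemidef (posSemidef_ofReal_smul (sub_nonneg.2 h) hB),
          trace_ofReal_smul_re, abs_sub_comm, abs_of_nonneg (sub_nonneg.2 h), mul_comm]
      · have h4 := traceNorm_sub_le (Matrix.PosSemidef.zero (R := ℂ) (n := Fin d))
          (posSemidef_ofReal_smul (sub_nonneg.2 h) hB)
        have h5 : (0 : Matrix (Fin d) (Fin d) ℂ) - ((x - y : ℝ) : ℂ) • B =
            ((y - x : ℝ) : ℂ) • B := by
          rw [zero_sub, ← neg_smul]; congr 1; push_cast; ring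
        rw [h5, trace_ofReal_smul_re] at h4
        rw [abs_of_nonneg (sub_nonneg.2 h)]
        simp only [Matrix.trace_zero, Complex.zero_re, zero_add] at h4
        linarith
    linarith
  rw [abs_sub_le_iff]
  refine ⟨key x y, ?_⟩
  rw [abs_sub_comm]; exact key y x

/-- Used to pass from generic prior weights to all of them. -/
theorem continuous_traceNorm_sub (hA : A.IsHermitian) (hB : B.PosSemidef) :
    Continuous fun x : ℝ => traceNorm (A - (x : ℂ) • B) :=
  (LipschitzWith.of_dist_le_mul (K := ⟨B.trace.re, trace_re_nonneg hB⟩)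
    fun x y => abs_traceNorm_sub_le hA hB x y).continuous

end traceNorm

/-! ### Support weights from small prior weights, and generic supports. -/

section support

variable {d : ℕ} {ρ σ ρ' σ' : Matrix (Fin d) (Fin d) ℂ}

theorem cfc_const_real (hσ : σ.IsHermitian) (b : ℝ) :
    cfc (fun _ : ℝ => b) σ = (b : ℂ) • (1 : Matrix (Fin d) (Fin d) ℂ) := by
  rw [cfc_const b σ (show IsSelfAdjoint σ from hσ), Algebra.algebraMap_eq_smul_one]
  ext i j; simp

theorem exists_smul_one_sub_posSemidef (hσ : σ.IsHermitian) :
    ∃ b : ℝ, 0 < b ∧ ((b : ℂ) • 1 - σ).PosSemidef := by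
  obtain ⟨b, hb⟩ := (Matrix.finite_real_spectrum (A := σ)).bddAbove
  refine ⟨max b 1, lt_max_of_lt_right one_pos, ?_⟩
  rw [← cfc_const_real hσ]
  conv => arg 1; rhs; rw [← cfc_self hσ]
  rw [cfc_sub_cfc]
  exact posSemidef_cfc fun x hx => sub_nonneg.2 ((hb hx).trans (le_max_left _ _))

/-- First-order expansion of the trace norm of `ρ - x σ` at `x = 0`, as an upper bound. -/
theorem exists_traceNorm_sub_le (hρ : ρ.PosSemidef) (hσ : σ.PosSemidef) :
    ∃ c δ : ℝ, 0 < δ ∧ ∀ x : ℝ, 0 < x → x ≤ δ → traceNorm (ρ - (x : ℂ) • σ) ≤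
      ρ.trace.re - x * σ.trace.re + 2 * x * (σ.trace.re - (σ * suppProj ρ).trace.re) +
        c * x ^ 2 := by
  obtain ⟨l2, hl2, hρl⟩ := exists_smul_suppProj_le hρ
  obtain ⟨b, hb, hbσ⟩ := exists_smul_one_sub_posSemidef hσ.1
  -- Half of the gap `2l` pays for the off-diagonal blocks of `σ`, the other half for its diagonal
  -- block on the support of `ρ`.
  obtain ⟨l, rfl⟩ : ∃ l, l2 = 2 * l := ⟨l2 / 2, by ring⟩
  have hl : 0 < l := by linarith
  set s := suppProj ρ with hs
  have hsh : sᴴ = s := suppProj_isHermitian.eq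
  have hss : s * s = s := suppProj_mul_self
  set u : Matrix (Fin d) (Fin d) ℂ := 1 - s with hu
  have huh : uᴴ = u := by rw [hu, Matrix.conjTranspose_sub, hsh, Matrix.conjTranspose_one]
  have huu : u * u = u := by simp only [hu, sub_mul, mul_sub, one_mul, mul_one, hss]; abel
  refine ⟨2 * (u * (σ * σ) * u).trace.re / l, l / b, div_pos hl hb, fun x hx hxd => ?_⟩
  obtain ⟨y, rfl⟩ : ∃ y, x = l * y := ⟨x / l, by field_simp⟩
  have hy : 0 < y := pos_of_mul_pos_right hx hl.le
  have hxb : 0 ≤ l - l * y * b := by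
    rw [le_div_iff₀ hb] at hxd; linarith
  -- `N` is a correction living on the kernel of `ρ` that makes `ρ - xσ + N` nonnegative. Its trace
  -- has the wanted first-order term plus a term of order `x²`.
  set N : Matrix (Fin d) (Fin d) ℂ := ((l * y : ℝ) : ℂ) • (u * σ * u) +
    ((l * y ^ 2 : ℝ) : ℂ) • (u * (σ * σ) * u) with hN
  set W : Matrix (Fin d) (Fin d) ℂ := s - (y : ℂ) • (σ * u) with hW
  have hWh : Wᴴ = s - (y : ℂ) • (u * σ) := by
    rw [hW, Matrix.conjTranspose_sub, Matrix.conjTranspose_smul, Matrix.conjTranspose_mul, hsh,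
      huh, hσ.1.eq]
    simp
  have hNp : N.PosSemidef := by
    have h1 := hσ.conjTranspose_mul_mul_same u
    have h2 : (u * (σ * σ) * u).PosSemidef := by
      have h2 := Matrix.posSemidef_conjTranspose_mul_self (σ * u)
      rw [Matrix.conjTranspose_mul, huh, hσ.1.eq] at h2
      simpa only [mul_assoc] using h2
    rw [huh] at h1
    exact (posSemidef_ofReal_smul hx.le h1).add (posSemidef_ofReal_smul (by positivity) h2)
  -- Completing the square: the sum of `ρ - 2l s`, `l W†W`, `x s(b - σ)s` and `(l - xb) s`, where
  -- the last is nonnegative because `x ≤ l / b`.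
  have hAp : (ρ - ((l * y : ℝ) : ℂ) • σ + N).PosSemidef := by
    have h1 := posSemidef_ofReal_smul hl.le (Matrix.posSemidef_conjTranspose_mul_self W)
    have h2 := posSemidef_ofReal_smul hx.le (hbσ.conjTranspose_mul_mul_same s)
    have h3 := posSemidef_ofReal_smul hxb
      (posSemidef_of_isHermitian_mul_self (A := s) suppProj_isHermitian hss)
    have h4 := ((hρl.add h1).add h2).add h3
    convert h4 using 1
    rw [hWh, hN, hW, hsh, hu]
    simp only [sub_mul, mul_sub, one_mul, mul_one, mul_assoc, hss, smul_sub, smul_mul_assoc,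
      mul_smul_comm]
    push_cast
    module
  have h := traceNorm_sub_le hAp hNp
  rw [add_sub_cancel_right] at h
  refine h.trans_eq ?_
  have h5 : (u * σ * u).trace.re = σ.trace.re - (σ * s).trace.re := by
    rw [Matrix.trace_mul_comm, ← mul_assoc, huu, Matrix.trace_mul_comm, hu, mul_sub, mul_one,
      Matrix.trace_sub, Complex.sub_re]
  have h6 : N.trace.re = l * y * (σ.trace.re - (σ * s).trace.re) +
      l * y ^ 2 * (u * (σ * σ) * u).trace.re := by
    rw [hN, Matrix.trace_add, Complex.add_re, trace_ofReal_smul_re, trace_ofReal_smul_re, h5]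
  rw [Matrix.trace_add, Matrix.trace_sub, Complex.add_re, Complex.sub_re, trace_ofReal_smul_re, h6]
  have h7 : 2 * (u * (σ * σ) * u).trace.re / l * (l * y) ^ 2 =
      2 * (l * y ^ 2 * (u * (σ * σ) * u).trace.re) := by field_simp
  rw [h7]
  ring

/-- The weight of one state on the support of another is determined by how distinguishable the
two are for small prior weights. -/
theorem trace_mul_suppProj_le (hρ : ρ.PosSemidef) (hσ : σ.PosSemidef) (hρ' : ρ'.PosSemidef)
    (hσ' : σ'.PosSemidef) (hρt : ρ'.trace = ρ.trace) (hσt : σ'.trace = σ.trace)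
    (h : ∀ x : ℝ, 0 ≤ x → traceNorm (ρ' - (x : ℂ) • σ') = traceNorm (ρ - (x : ℂ) • σ)) :
    (σ' * suppProj ρ').trace.re ≤ (σ * suppProj ρ).trace.re := by
  obtain ⟨c, δ, hδ, hc⟩ := exists_traceNorm_sub_le hρ' hσ'
  have key : ∀ x : ℝ, 0 < x → x ≤ δ →
      2 * ((σ' * suppProj ρ').trace.re - (σ * suppProj ρ).trace.re) ≤ c * x := by
    intro x hx hxd
    have h1 := hc x hx hxd
    have hS := suppProj_isHermitian (A := ρ)
    have hS2 := suppProj_mul_self (A := ρ)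
    -- The support of `ρ` is used as a test for the lower bound on the unprimed pair; divided by
    -- `x`, the two bounds differ by `O(x)`.
    have h2 := two_mul_trace_le_traceNorm (hρ.1.sub (isHermitian_ofReal_smul x hσ.1))
      (posSemidef_of_isHermitian_mul_self hS hS2) (posSemidef_one_sub hS hS2)
    rw [sub_mul, mul_suppProj hρ.1, smul_mul_assoc, Matrix.trace_sub, Matrix.trace_sub,
      Complex.sub_re, Complex.sub_re, trace_ofReal_smul_re, trace_ofReal_smul_re,
      ← h x hx.le] at h2
    rw [hρt, hσt] at h1
    have h3 : x * (2 * ((σ' * suppProj ρ').trace.re - (σ * suppProj ρ).trace.re)) ≤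
        x * (c * x) := by nlinarith
    exact le_of_mul_le_mul_left h3 hx
  have hlim : Filter.Tendsto (fun x : ℝ => c * x) (nhdsWithin 0 (Set.Ioi 0)) (nhds (c * 0)) :=
    ((continuous_const.mul continuous_id).tendsto 0).mono_left nhdsWithin_le_nhds
  have h4 := ge_of_tendsto hlim (Filter.mem_of_superset (Ioc_mem_nhdsGT hδ)
    fun x hx => key x hx.1 hx.2)
  linarith

/-- For all but finitely many `x`, the support of `ρ - x σ` contains those of `ρ` and `σ`. -/
theorem dense_setOf_mul_suppProj (hρ : ρ.PosSemidef) (hσ : σ.PosSemidef) :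
    Dense {x : ℝ | ρ * suppProj (ρ - (x : ℂ) • σ) = ρ ∧ σ * suppProj (ρ - (x : ℂ) • σ) = σ} := by
  set s := suppProj (ρ + σ) with hs
  have hsh : s.IsHermitian := suppProj_isHermitian
  have hss : s * s = s := suppProj_mul_self
  have hsum : (ρ + σ).PosSemidef := hρ.add hσ
  have hker : ρ * (1 - s) = 0 ∧ σ * (1 - s) = 0 := by
    have hu : (1 - s)ᴴ = 1 - s := (Matrix.isHermitian_one.sub hsh).eq
    have h1 := hρ.conjTranspose_mul_mul_same (1 - s)
    have h2 := hσ.conjTranspose_mul_mul_same (1 - s)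
    have h3 : (1 - s)ᴴ * ρ * (1 - s) + (1 - s)ᴴ * σ * (1 - s) = 0 := by
      rw [← add_mul, ← mul_add, mul_assoc, mul_sub (ρ + σ), mul_one, hs, mul_suppProj hsum.1,
        sub_self, mul_zero]
    have h4 := congrArg (fun Y => Y.trace.re) h3
    simp only [Matrix.trace_add, Complex.add_re, Matrix.trace_zero, Complex.zero_re] at h4
    have h5 := trace_re_nonneg h1
    have h6 := trace_re_nonneg h2
    exact ⟨conj_eq_zero hρ (posSemidef_eq_zero_of_trace h1 (by linarith)),
      conj_eq_zero hσ (posSemidef_eq_zero_of_trace h2 (by linarith))⟩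
  have hρs : ρ * s = ρ := by
    have := hker.1; rw [mul_sub, mul_one, sub_eq_zero] at this; exact this.symm
  have hσs : σ * s = σ := by
    have := hker.2; rw [mul_sub, mul_one, sub_eq_zero] at this; exact this.symm
  -- Padding with `1 - s` removes the common kernel, so the exceptional `x` are among the roots of a
  -- determinant in `x`.
  set p : Polynomial ℂ := Matrix.det (((ρ + (1 - s)).map Polynomial.C) -
    (Polynomial.X : Polynomial ℂ) • (σ.map Polynomial.C)) with hp
  have heval : ∀ x : ℂ, p.eval x = (ρ - x • σ + (1 - s)).det := by
    intro x
    rw [hp, ← Polynomial.coe_evalRingHom, RingHom.map_det]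
    congr 1
    ext i j
    simp only [RingHom.mapMatrix_apply, Matrix.map_apply, Matrix.sub_apply, Matrix.smul_apply,
      Matrix.add_apply, map_sub, smul_eq_mul, Polynomial.coe_evalRingHom,
      Polynomial.eval_C, Polynomial.eval_mul, Polynomial.eval_X]
    ring
  -- At `x = -1` the matrix is `ρ + σ` padded on its kernel, which is invertible.
  have hp0 : p ≠ 0 := by
    have h1 : (ρ + σ + (1 - s)) * cfc (fun x : ℝ => if x = 0 then 1 else x⁻¹) (ρ + σ) = 1 := by
      have h2 : ρ + σ + (1 - s) =
          cfc (fun x : ℝ => x + (1 - if x = 0 then 0 else 1)) (ρ + σ) := by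
        rw [← cfc_add_cfc _ (fun x => x), cfc_self hsum.1, ← cfc_sub_cfc _ (fun _ => 1),
          cfc_const_real hsum.1, Complex.ofReal_one, one_smul, hs, suppProj]
      have h3 := cfc_const_real hsum.1 1
      rw [Complex.ofReal_one, one_smul] at h3
      rw [h2, cfc_mul_cfc, ← h3]
      congr 1; ext x; split_ifs with hx <;> simp [hx]
    intro h0
    have h3 := heval (-1)
    rw [h0, Polynomial.eval_zero, neg_one_smul, sub_neg_eq_add] at h3
    exact (Matrix.isUnit_det_of_right_inverse h1).ne_zero h3.symm
  have hfin : {x : ℝ | p.eval (x : ℂ) = 0}.Finite := by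
    have : {z : ℂ | p.IsRoot z}.Finite := Polynomial.finite_setOfPred_isRoot hp0
    exact this.preimage Complex.ofReal_injective.injOn
  refine (hfin.countable.dense_compl ℝ).mono fun x hx => ?_
  set X := ρ - (x : ℂ) • σ with hX
  have hXh : X.IsHermitian := hρ.1.sub (isHermitian_ofReal_smul x hσ.1)
  have hdet : (X + (1 - s)).det ≠ 0 := by rw [hX, ← heval]; exact hx
  have hXs : (X + (1 - s)) * s = X := by
    rw [add_mul, sub_mul 1, one_mul, hss, sub_self, add_zero, hX, sub_mul, smul_mul_assoc, hρs, hσs]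
  have hsX : s = (X + (1 - s))⁻¹ * X := by
    conv_rhs => rhs; rw [← hXs]
    rw [Matrix.nonsing_inv_mul_cancel_left _ _ (isUnit_iff_ne_zero.2 hdet)]
  have hsupp : s * suppProj X = s := by
    conv_lhs => lhs; rw [hsX]
    rw [mul_assoc, mul_suppProj hXh, ← hsX]
  constructor
  · conv_lhs => lhs; rw [← hρs]
    rw [mul_assoc, hsupp, hρs]
  · conv_lhs => lhs; rw [← hσs]
    rw [mul_assoc, hsupp, hσs]

end support

/-! ### Pulling optimal tests back through the Kraus operators. -/

section kraus

variable {d n : ℕ} {E : Matrix (Fin d) (Fin d) ℂ →ₗ[ℂ] Matrix (Fin d) (Fin d) ℂ}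
  {K : Fin n → Matrix (Fin d) (Fin d) ℂ} {A B X : Matrix (Fin d) (Fin d) ℂ}

/-- The Heisenberg-picture dual of the map with Kraus operators `K`. -/
noncomputable def krausDual (K : Fin n → Matrix (Fin d) (Fin d) ℂ) (T : Matrix (Fin d) (Fin d) ℂ) :
    Matrix (Fin d) (Fin d) ℂ := ∑ i, (K i)ᴴ * T * K i

theorem krausDual_sub : krausDual K (A - B) = krausDual K A - krausDual K B := by
  simp [krausDual, mul_sub, sub_mul]

theorem krausDual_one (hK : ∑ i, (K i)ᴴ * K i = 1) : krausDual K 1 = 1 := by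
  simp [krausDual, hK]

theorem krausDual_posSemidef (hA : A.PosSemidef) : (krausDual K A).PosSemidef :=
  Matrix.posSemidef_sum _ fun i _ => hA.conjTranspose_mul_mul_same (K i)

theorem kraus_posSemidef (hE : ∀ ρ, E ρ = ∑ i, K i * ρ * (K i)ᴴ) (hA : A.PosSemidef) :
    (E A).PosSemidef := by
  rw [hE]; exact Matrix.posSemidef_sum _ fun i _ => hA.mul_mul_conjTranspose_same (K i)

theorem kraus_isHermitian (hE : ∀ ρ, E ρ = ∑ i, K i * ρ * (K i)ᴴ) (hA : A.IsHermitian) :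
    (E A).IsHermitian := by
  rw [hE, Matrix.IsHermitian, Matrix.conjTranspose_sum]
  simp [Matrix.conjTranspose_mul, hA.eq, mul_assoc]

theorem trace_kraus_mul (hE : ∀ ρ, E ρ = ∑ i, K i * ρ * (K i)ᴴ) :
    (E A * B).trace = (A * krausDual K B).trace := by
  rw [hE, krausDual, Finset.sum_mul, Finset.mul_sum, Matrix.trace_sum, Matrix.trace_sum]
  refine Finset.sum_congr rfl fun i _ => ?_
  rw [mul_assoc, mul_assoc, Matrix.trace_mul_comm]
  simp only [mul_assoc]

theorem trace_kraus (hE : ∀ ρ, E ρ = ∑ i, K i * ρ * (K i)ᴴ) (hK : ∑ i, (K i)ᴴ * K i = 1) :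
    (E A).trace = A.trace := by
  have := trace_kraus_mul (A := A) (B := 1) hE
  rwa [krausDual_one hK, mul_one, mul_one] at this

theorem eq_zero_of_sum_conjTranspose_mul_self {M : Fin n → Matrix (Fin d) (Fin d) ℂ}
    (h : ∑ i, (M i)ᴴ * M i = 0) (i : Fin n) : M i = 0 := by
  have h1 : ∑ i, ((M i)ᴴ * M i).trace.re = 0 := by
    rw [← Complex.re_sum, ← Matrix.trace_sum, h]; simp
  have h2 := (Finset.sum_eq_zero_iff_of_nonneg fun i _ =>
    trace_re_nonneg (Matrix.posSemidef_conjTranspose_mul_self (M i))).1 h1 i (Finset.mem_univ i)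
  exact Matrix.conjTranspose_mul_self_eq_zero.1
    (posSemidef_eq_zero_of_trace (Matrix.posSemidef_conjTranspose_mul_self (M i)) h2)

/-- `p` is the projection onto the joint support of the code `C`. -/
structure IsCodeSupport (C : Set (Matrix (Fin d) (Fin d) ℂ)) (p : Matrix (Fin d) (Fin d) ℂ) :
    Prop where
  isHermitian : p.IsHermitian
  mul_self : p * p = p
  mul_eq : ∀ ρ ∈ C, p * ρ = ρ
  mul_eq_zero : ∀ Z : Matrix (Fin d) (Fin d) ℂ, (∀ ρ ∈ C, Z * ρ = 0) → Z * p = 0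

theorem exists_isCodeSupport {C : Set (Matrix (Fin d) (Fin d) ℂ)}
    (hC : ∀ ρ ∈ C, ρ.PosSemidef) : ∃ p, IsCodeSupport C p := by
  -- A code may be infinite; a finite spanning subset already determines the joint support, as the
  -- support of its sum.
  obtain ⟨b, hbC, hspan, hli⟩ := exists_linearIndependent ℂ C
  have hfin : b.Finite := hli.setFinite
  set ω := ∑ ρ ∈ hfin.toFinset, ρ with hω
  have hωp : ω.PosSemidef := Matrix.posSemidef_sum _ fun ρ hρ =>
    hC ρ (hbC (hfin.mem_toFinset.1 hρ))
  set p := suppProj ω with hp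
  have hph : p.IsHermitian := suppProj_isHermitian
  have hpp : p * p = p := suppProj_mul_self
  refine ⟨p, hph, hpp, ?_, ?_⟩
  · have huh : (1 - p)ᴴ = 1 - p := (Matrix.isHermitian_one.sub hph).eq
    have h1 : ∑ ρ ∈ hfin.toFinset, ((1 - p) * ρ * (1 - p)ᴴ).trace.re = 0 := by
      rw [← Complex.re_sum, ← Matrix.trace_sum, ← Finset.sum_mul, ← Finset.mul_sum, ← hω,
        sub_mul 1 p ω, one_mul, hp, suppProj_mul hωp.1, sub_self]
      simp
    have h2 : ∀ ρ ∈ b, (1 - p) * ρ = 0 := by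
      intro ρ hρ
      have hρp := hC ρ (hbC hρ)
      have h3 := (Finset.sum_eq_zero_iff_of_nonneg fun ρ hρ => trace_re_nonneg
        ((hC ρ (hbC (hfin.mem_toFinset.1 hρ))).mul_mul_conjTranspose_same (1 - p))).1 h1 ρ
        (hfin.mem_toFinset.2 hρ)
      have h4 := posSemidef_eq_zero_of_trace (hρp.mul_mul_conjTranspose_same (1 - p)) h3
      have h5 := conj_eq_zero (M := (1 - p)) hρp (by rwa [huh] at h4 ⊢)
      have h6 := congrArg Matrix.conjTranspose h5
      rwa [Matrix.conjTranspose_mul, huh, hρp.1.eq, Matrix.conjTranspose_zero] at h6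
    intro ρ hρ
    have h3 : ρ ∈ Submodule.span ℂ b := hspan ▸ Submodule.subset_span hρ
    have h4 : (1 - p) * ρ = 0 := by
      clear hρ
      induction h3 using Submodule.span_induction with
      | mem x hx => exact h2 x hx
      | zero => exact mul_zero _
      | add x y _ _ hx hy => rw [mul_add, hx, hy, add_zero]
      | smul a x _ hx => rw [mul_smul_comm, hx, smul_zero]
    rw [sub_mul, one_mul, sub_eq_zero] at h4
    exact h4.symm
  · intro Z hZ
    have h1 : Z * ω = 0 := by
      rw [hω, Finset.mul_sum]
      exact Finset.sum_eq_zero fun ρ hρ => hZ ρ (hbC (hfin.mem_toFinset.1 hρ))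
    obtain ⟨Y, hY⟩ := suppProj_eq_mul hωp.1
    have h2 : p = ω * Yᴴ := by
      rw [← hph.eq, hp, hY, Matrix.conjTranspose_mul, hωp.1.eq]
    rw [h2, ← mul_assoc, h1, zero_mul]

/-- For `x ≤ 0` the combination is nonnegative, so only trace preservation is involved. -/
theorem IsPreservedCode.traceNorm_eq {C : Set (Matrix (Fin d) (Fin d) ℂ)}
    (hE : ∀ ρ, E ρ = ∑ i, K i * ρ * (K i)ᴴ) (hK : ∑ i, (K i)ᴴ * K i = 1)
    (hC : IsPreservedCode E C) {ρ σ : Matrix (Fin d) (Fin d) ℂ} (hρ : ρ ∈ C) (hσ : σ ∈ C)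
    (x : ℝ) : traceNorm (E (ρ - (x : ℂ) • σ)) = traceNorm (ρ - (x : ℂ) • σ) := by
  rcases le_total 0 x with hx | hx
  · exact hC.2 ρ hρ σ hσ x hx
  · have h1 : (ρ - (x : ℂ) • σ).PosSemidef := by
      have := (hC.1 hρ).1.add (posSemidef_ofReal_smul (neg_nonneg.2 hx) (hC.1 hσ).1)
      rwa [Complex.ofReal_neg, neg_smul, ← sub_eq_add_neg] at this
    rw [traceNorm_of_posSemidef h1, traceNorm_of_posSemidef (kraus_posSemidef hE h1),
      trace_kraus hE hK]

theorem suppProj_mul_codeSupport {C : Set (Matrix (Fin d) (Fin d) ℂ)}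
    {p ρ : Matrix (Fin d) (Fin d) ℂ} (hp : IsCodeSupport C p) (hρ : ρ ∈ C) (hρh : ρ.IsHermitian) :
    suppProj ρ * p = suppProj ρ ∧ p * suppProj ρ = suppProj ρ := by
  obtain ⟨Y, hY⟩ := suppProj_eq_mul hρh
  have hs := suppProj_isHermitian (A := ρ)
  have h1 : suppProj ρ = ρ * Yᴴ := by
    rw [← hs.eq, hY, Matrix.conjTranspose_mul, hρh.eq]
  have h2 : p * suppProj ρ = suppProj ρ := by rw [h1, ← mul_assoc, hp.mul_eq ρ hρ]
  have h3 := congrArg Matrix.conjTranspose h2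
  rw [Matrix.conjTranspose_mul, hs.eq, hp.isHermitian.eq] at h3
  exact ⟨h3, h2⟩

/-- On a preserved code, the support projection of an output state pulls back to the support
projection of the input state. -/
theorem kraus_mul_sub_suppProj {C : Set (Matrix (Fin d) (Fin d) ℂ)}
    (hE : ∀ ρ, E ρ = ∑ i, K i * ρ * (K i)ᴴ) (hK : ∑ i, (K i)ᴴ * K i = 1)
    (hC : IsPreservedCode E C) {p ρ : Matrix (Fin d) (Fin d) ℂ} (hp : IsCodeSupport C p)
    (hρ : ρ ∈ C) (i : Fin n) : E ρ * K i * (p - suppProj ρ) = 0 := by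
  have hρp := (hC.1 hρ).1
  have hρE := kraus_posSemidef hE hρp
  set s := suppProj ρ with hs
  set s' := suppProj (E ρ) with hs'
  set T := krausDual K s' with hT
  have hsh : s.IsHermitian := suppProj_isHermitian
  have hss : s * s = s := suppProj_mul_self
  have hsh' : s'.IsHermitian := suppProj_isHermitian
  have hss' : s' * s' = s' := suppProj_mul_self
  have hTp : T.PosSemidef := krausDual_posSemidef (posSemidef_of_isHermitian_mul_self hsh' hss')
  have hTp' : (1 - T).PosSemidef := by
    have := krausDual_posSemidef (K := K) (posSemidef_one_sub hsh' hss')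
    rwa [krausDual_sub, krausDual_one hK] at this
  have hρT : ρ * T = ρ := by
    have h1 : (ρ * (1 - T)).trace.re = 0 := by
      rw [mul_sub, mul_one, Matrix.trace_sub, hT, ← trace_kraus_mul hE, hs', mul_suppProj hρE.1,
        trace_kraus hE hK, sub_self, Complex.zero_re]
    have h2 := mul_eq_zero_of_trace hρp hTp' h1
    rw [mul_sub, mul_one, sub_eq_zero] at h2
    exact h2.symm
  have hsT : s * T = s := by
    obtain ⟨Y, hY⟩ := suppProj_eq_mul hρp.1
    rw [hs, hY, mul_assoc, hρT]
  have hTs : T * s = s := by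
    have := congrArg Matrix.conjTranspose hsT
    rwa [Matrix.conjTranspose_mul, hsh.eq, hTp.1.eq] at this
  -- Since `T` acts as the identity on the range of `s`, `T - s` equals `(1 - s) T (1 - s)`.
  have hTsp : (T - s).PosSemidef := by
    have h1 := hTp.conjTranspose_mul_mul_same (1 - s)
    rw [(Matrix.isHermitian_one.sub hsh).eq] at h1
    convert h1 using 1
    simp only [mul_sub, sub_mul, one_mul, mul_one, hsT, hTs, hss]; abel
  -- The weight on the support cannot grow from input to output, while `T ≥ s` says it cannot
  -- shrink.
  have hcode : ∀ σ ∈ C, (T - s) * σ = 0 := by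
    intro σ hσ
    have hσp := (hC.1 hσ).1
    have h1 := trace_mul_suppProj_le hρp hσp hρE (kraus_posSemidef hE hσp) (trace_kraus hE hK)
      (trace_kraus hE hK) fun x _ => by
        rw [← hC.traceNorm_eq hE hK hρ hσ x, map_sub, map_smul]
    rw [← hs', ← hs, trace_kraus_mul hE, ← hT] at h1
    have h2 := trace_mul_re_nonneg hTsp hσp
    refine mul_eq_zero_of_trace hTsp hσp (le_antisymm ?_ h2)
    rw [Matrix.trace_mul_comm, mul_sub, Matrix.trace_sub, Complex.sub_re]
    linarith
  have h0 := hp.mul_eq_zero _ hcode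
  have hsp : s * p = s := (suppProj_mul_codeSupport hp hρ hρp.1).1
  have hTR : T * (p - s) = 0 := by
    rw [sub_mul, hsp, sub_eq_zero] at h0
    rw [mul_sub, hTs, h0, sub_self]
  have hsum : ∑ i, (s' * K i * (p - s))ᴴ * (s' * K i * (p - s)) = 0 := by
    have h1 : (p - s)ᴴ * (T * (p - s)) = ∑ i, (s' * K i * (p - s))ᴴ * (s' * K i * (p - s)) := by
      rw [hT, krausDual, Finset.sum_mul, Finset.mul_sum]
      refine Finset.sum_congr rfl fun i _ => ?_
      have h2 : ∀ Y, s' * (s' * Y) = s' * Y := fun Y => by rw [← mul_assoc, hss']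
      simp only [Matrix.conjTranspose_mul, hsh'.eq, mul_assoc, h2]
    rw [← h1, hTR, mul_zero]
  have h3 := eq_zero_of_sum_conjTranspose_mul_self hsum i
  rw [← mul_suppProj hρE.1, mul_assoc, mul_assoc, ← mul_assoc s', h3, mul_zero]

/-- On a preserved code, the optimal test between two output states pulls back to the optimal test
between the input states. -/
theorem posProj_mul_kraus {C : Set (Matrix (Fin d) (Fin d) ℂ)}
    (hE : ∀ ρ, E ρ = ∑ i, K i * ρ * (K i)ᴴ) (hK : ∑ i, (K i)ᴴ * K i = 1)
    (hC : IsPreservedCode E C) {p ρ σ : Matrix (Fin d) (Fin d) ℂ} (hp : IsCodeSupport C p)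
    (hρ : ρ ∈ C) (hσ : σ ∈ C) {x : ℝ} (hρX : ρ * suppProj (ρ - (x : ℂ) • σ) = ρ)
    (hσX : σ * suppProj (ρ - (x : ℂ) • σ) = σ) :
    (∀ i, posProj (E (ρ - (x : ℂ) • σ)) * K i * p = K i * posProj (ρ - (x : ℂ) • σ)) ∧
      p * posProj (ρ - (x : ℂ) • σ) = posProj (ρ - (x : ℂ) • σ) := by
  have hρp := (hC.1 hρ).1
  have hσp := (hC.1 hσ).1
  have hnorm := hC.traceNorm_eq hE hK hρ hσ x
  have hEX : E (ρ - (x : ℂ) • σ) = E ρ - (x : ℂ) • E σ := by rw [map_sub, map_smul]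
  set X := ρ - (x : ℂ) • σ with hX
  have hXh : X.IsHermitian := hρp.1.sub (isHermitian_ofReal_smul x hσp.1)
  have hYh : (E X).IsHermitian := kraus_isHermitian hE hXh
  set Q := posProj (E X) with hQ
  set P := posProj X with hP
  set T := krausDual K Q with hT
  have hQh : Q.IsHermitian := posProj_isHermitian
  have hQQ : Q * Q = Q := posProj_mul_self
  have hPh : P.IsHermitian := posProj_isHermitian
  have hPP : P * P = P := posProj_mul_self
  have hTp : T.PosSemidef := krausDual_posSemidef (posSemidef_of_isHermitian_mul_self hQh hQQ)
  have hTp' : (1 - T).PosSemidef := by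
    have := krausDual_posSemidef (K := K) (posSemidef_one_sub hQh hQQ)
    rwa [krausDual_sub, krausDual_one hK] at this
  have hpX : p * X = X := by
    rw [hX, mul_sub, mul_smul_comm, hp.mul_eq ρ hρ, hp.mul_eq σ hσ]
  have hpP : p * P = P := by
    obtain ⟨Z, hZ⟩ := posProj_eq_mul hXh
    have h1 : P = X * Zᴴ := by rw [← hPh.eq, hP, hZ, Matrix.conjTranspose_mul, hXh.eq]
    rw [h1, ← mul_assoc, hpX]
  have hPp : P * p = P := by
    have := congrArg Matrix.conjTranspose hpP
    rwa [Matrix.conjTranspose_mul, hPh.eq, hp.isHermitian.eq] at this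
  -- The pulled-back test attains the optimum, hence equals `1` on the positive part of `X` and `0`
  -- on the negative part.
  have htr : (X * T).trace.re = (posPt X).trace.re := by
    rw [hT, ← trace_kraus_mul hE]
    have h1 := traceNorm_eq_two_mul hYh
    have h2 := traceNorm_isHermitian hXh
    have h3 := trace_posPt_sub hXh
    rw [trace_kraus hE hK] at h1
    linarith
  have h1 := trace_mul_re_nonneg (posPt_posSemidef (A := X)) hTp'
  have h2 := trace_mul_re_nonneg (negPt_posSemidef (A := X)) hTp
  have h3 : (X * T).trace.re = (posPt X * T).trace.re - (negPt X * T).trace.re := by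
    rw [← Complex.sub_re, ← Matrix.trace_sub, ← sub_mul, posPt_sub_negPt hXh]
  have h4 : (posPt X * (1 - T)).trace.re = (posPt X).trace.re - (posPt X * T).trace.re := by
    rw [mul_sub, mul_one, Matrix.trace_sub, Complex.sub_re]
  have h5 : posPt X * (1 - T) = 0 :=
    mul_eq_zero_of_trace posPt_posSemidef hTp' (by linarith)
  have h6 : negPt X * T = 0 := mul_eq_zero_of_trace negPt_posSemidef hTp (by linarith)
  have h5' : (1 - T) * posPt X = 0 := by
    have := congrArg Matrix.conjTranspose h5
    rwa [Matrix.conjTranspose_mul, hTp'.1.eq, posPt_posSemidef.1.eq, Matrix.conjTranspose_zero]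
      at this
  have h6' : T * negPt X = 0 := by
    have := congrArg Matrix.conjTranspose h6
    rwa [Matrix.conjTranspose_mul, hTp.1.eq, negPt_posSemidef.1.eq, Matrix.conjTranspose_zero]
      at this
  have hTP : T * P = P := by
    obtain ⟨Z, hZ⟩ := posProj_eq_posPt_mul (A := X)
    have h7 : (1 - T) * P = 0 := by rw [hP, hZ, ← mul_assoc, h5', zero_mul]
    rw [sub_mul, one_mul, sub_eq_zero] at h7
    exact h7.symm
  have hTsupp : T * suppProj X = P := by
    obtain ⟨Z, hZ⟩ := suppProj_eq_posProj_add (A := X)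
    rw [hZ, mul_add, ← mul_assoc, h6', zero_mul, add_zero, ← hP, hTP]
  -- Controls `T` on the part of `p` in the kernel of `X`, where optimality says nothing. The
  -- support of `X` contains that of `τ`, so `p - suppProj X` lies below `p - suppProj τ`.
  have hkill : ∀ τ ∈ C, τ * suppProj X = τ → ∀ j, E τ * K j * (p - suppProj X) = 0 := by
    intro τ hτ hτX j
    have hτh := (hC.1 hτ).1.1
    have h7 : (p - suppProj τ) * (p - suppProj X) = p - suppProj X := by
      have h8 : suppProj τ * (p - suppProj X) = 0 := by
        obtain ⟨Y, hY⟩ := suppProj_eq_mul hτh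
        rw [mul_sub, (suppProj_mul_codeSupport hp hτ hτh).1, hY, mul_assoc, hτX, sub_self]
      have h9 : p * suppProj X = suppProj X := by
        obtain ⟨Z, hZ⟩ := suppProj_eq_mul hXh
        have hs := suppProj_isHermitian (A := X)
        have h10 : suppProj X = X * Zᴴ := by
          rw [← hs.eq, hZ, Matrix.conjTranspose_mul, hXh.eq]
        rw [h10, ← mul_assoc, hpX]
      rw [sub_mul, h8, sub_zero, mul_sub, hp.mul_self, h9]
    rw [← h7, ← mul_assoc, kraus_mul_sub_suppProj hE hK hC hp hτ j, zero_mul]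
  have hQkill : ∀ j, Q * K j * (p - suppProj X) = 0 := by
    intro j
    obtain ⟨Z, hZ⟩ := posProj_eq_mul hYh
    rw [hQ, hZ, hEX, mul_assoc, mul_assoc, ← mul_assoc (E ρ - _), sub_mul, sub_mul, hkill ρ hρ hρX j,
      smul_mul_assoc, smul_mul_assoc, hkill σ hσ hσX j, smul_zero, sub_zero, mul_zero]
  have hTp0 : T * p = P := by
    have h7 : T * (p - suppProj X) = 0 := by
      rw [hT, krausDual, Finset.sum_mul]
      refine Finset.sum_eq_zero fun j _ => ?_
      rw [mul_assoc, mul_assoc, ← mul_assoc Q, hQkill, mul_zero]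
    rw [mul_sub, hTsupp, sub_eq_zero] at h7
    exact h7
  refine ⟨fun i => ?_, hpP⟩
  -- Expanding, each of the four terms sums to `±P`, by `T p = P` and the Kraus normalisation. A
  -- vanishing sum of squares then gives the intertwining for each Kraus operator separately.
  have hsum : ∑ j, (Q * K j * p - K j * P)ᴴ * (Q * K j * p - K j * P) = 0 := by
    have h7 : ∀ j, (Q * K j * p - K j * P)ᴴ * (Q * K j * p - K j * P) =
        p * ((K j)ᴴ * Q * K j) * p - p * ((K j)ᴴ * Q * K j) * P - P * ((K j)ᴴ * Q * K j) * p +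
          P * ((K j)ᴴ * K j) * P := by
      intro j
      have h8 : ∀ Y, Q * (Q * Y) = Q * Y := fun Y => by rw [← mul_assoc, hQQ]
      simp only [Matrix.conjTranspose_sub, Matrix.conjTranspose_mul, hQh.eq, hPh.eq,
        hp.isHermitian.eq, mul_sub, sub_mul, mul_assoc, h8]
      abel
    simp only [h7, Finset.sum_add_distrib, Finset.sum_sub_distrib, ← Finset.mul_sum,
      ← Finset.sum_mul, hK]
    change p * T * p - p * T * P - P * T * p + P * 1 * P = 0
    rw [mul_assoc, hTp0, mul_assoc, hTP, mul_assoc, hTp0, hpP, mul_one, hPP]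
    abel
  exact sub_eq_zero.1 (eq_zero_of_sum_conjTranspose_mul_self hsum i)

end kraus

/-! ### The intertwined algebra and its conditional expectation. -/

section algebra

variable {d n : ℕ} {E : Matrix (Fin d) (Fin d) ℂ →ₗ[ℂ] Matrix (Fin d) (Fin d) ℂ}
  {K : Fin n → Matrix (Fin d) (Fin d) ℂ}

/-- The operators on the subspace of `p` that are intertwined, through every Kraus operator, with
an operator on the output system. -/
def krausAlgebra (K : Fin n → Matrix (Fin d) (Fin d) ℂ) {p : Matrix (Fin d) (Fin d) ℂ}
    (hp : p.IsHermitian) : NonUnitalStarSubalgebra ℂ (Matrix (Fin d) (Fin d) ℂ) where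
  carrier := {m | p * m = m ∧ m * p = m ∧
    ∃ a : Matrix (Fin d) (Fin d) ℂ, ∀ i, a * K i * p = K i * m ∧ aᴴ * K i * p = K i * mᴴ}
  zero_mem' := ⟨mul_zero _, zero_mul _, 0, fun i => by simp⟩
  add_mem' := by
    rintro m m' ⟨h1, h2, a, ha⟩ ⟨h1', h2', a', ha'⟩
    refine ⟨by rw [mul_add, h1, h1'], by rw [add_mul, h2, h2'], a + a', fun i => ⟨?_, ?_⟩⟩
    · rw [add_mul, add_mul, (ha i).1, (ha' i).1, mul_add]
    · rw [Matrix.conjTranspose_add, add_mul, add_mul, (ha i).2, (ha' i).2,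
        Matrix.conjTranspose_add, mul_add]
  mul_mem' := by
    rintro m m' ⟨h1, h2, a, ha⟩ ⟨h1', h2', a', ha'⟩
    refine ⟨by rw [← mul_assoc, h1], by rw [mul_assoc, h2'], a * a', fun i => ⟨?_, ?_⟩⟩
    · rw [mul_assoc, mul_assoc, ← mul_assoc a', (ha' i).1, ← h1', ← mul_assoc (K i), ← mul_assoc a,
        ← mul_assoc a, (ha i).1, h1', mul_assoc]
    · have h3 : p * mᴴ = mᴴ := by rw [← hp.eq, ← Matrix.conjTranspose_mul, h2]
      rw [Matrix.conjTranspose_mul, mul_assoc, mul_assoc, ← mul_assoc aᴴ, (ha i).2, ← h3,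
        ← mul_assoc (K i), ← mul_assoc a'ᴴ, ← mul_assoc a'ᴴ, (ha' i).2,
        Matrix.conjTranspose_mul, mul_assoc]
  smul_mem' := by
    rintro c m ⟨h1, h2, a, ha⟩
    refine ⟨by rw [mul_smul_comm, h1], by rw [smul_mul_assoc, h2], c • a, fun i => ⟨?_, ?_⟩⟩
    · rw [smul_mul_assoc, smul_mul_assoc, (ha i).1, mul_smul_comm]
    · rw [Matrix.conjTranspose_smul, smul_mul_assoc, smul_mul_assoc, (ha i).2,
        Matrix.conjTranspose_smul, mul_smul_comm]
  star_mem' := by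
    rintro m ⟨h1, h2, a, ha⟩
    refine ⟨?_, ?_, aᴴ, fun i => ⟨(ha i).2, ?_⟩⟩
    · rw [Matrix.star_eq_conjTranspose, ← hp.eq, ← Matrix.conjTranspose_mul, h2]
    · rw [Matrix.star_eq_conjTranspose, ← hp.eq, ← Matrix.conjTranspose_mul, h1]
    · rw [Matrix.star_eq_conjTranspose, Matrix.conjTranspose_conjTranspose,
        Matrix.conjTranspose_conjTranspose]
      exact (ha i).1

theorem mem_krausAlgebra {p m : Matrix (Fin d) (Fin d) ℂ} {hp : p.IsHermitian} :
    m ∈ krausAlgebra K hp ↔ p * m = m ∧ m * p = m ∧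
      ∃ a : Matrix (Fin d) (Fin d) ℂ, ∀ i, a * K i * p = K i * m ∧ aᴴ * K i * p = K i * mᴴ :=
  Iff.rfl

/-- The map with Kraus operators `K` is isometric on the Hermitian part of `krausAlgebra K`. -/
theorem traceNorm_kraus_of_mem (hE : ∀ ρ, E ρ = ∑ i, K i * ρ * (K i)ᴴ)
    (hK : ∑ i, (K i)ᴴ * K i = 1) {p X : Matrix (Fin d) (Fin d) ℂ} {hp : p.IsHermitian}
    (hX : X.IsHermitian) (hXM : X ∈ krausAlgebra K hp) : traceNorm (E X) = traceNorm X := by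
  have hA : posPt X ∈ krausAlgebra K hp := cfc_mem_algebra _ hX hXM (by simp)
  have hB : negPt X ∈ krausAlgebra K hp := cfc_mem_algebra _ hX hXM (by simp)
  obtain ⟨-, -, a, ha⟩ := mem_krausAlgebra.1 hA
  obtain ⟨hpB, -, -⟩ := mem_krausAlgebra.1 hB
  have hAh := posPt_posSemidef (A := X)
  have hBh := negPt_posSemidef (A := X)
  -- The intertwiner of `posPt X` moves it past the Kraus operators until it meets `negPt X`; so `E`
  -- keeps the two parts orthogonal, and their traces.
  have h0 : E (posPt X) * E (negPt X) = 0 := by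
    rw [hE, hE, Finset.sum_mul]
    refine Finset.sum_eq_zero fun i _ => ?_
    rw [Finset.mul_sum]
    refine Finset.sum_eq_zero fun j _ => ?_
    have h1 : posPt X * (K i)ᴴ = p * (K i)ᴴ * aᴴ := by
      have := congrArg Matrix.conjTranspose (ha i).1
      rw [Matrix.conjTranspose_mul, Matrix.conjTranspose_mul, Matrix.conjTranspose_mul, hp.eq,
        hAh.1.eq] at this
      rw [← this, mul_assoc]
    have h2 : aᴴ * (K j * negPt X) = 0 := by
      rw [← hpB, ← mul_assoc (K j), ← mul_assoc aᴴ, ← mul_assoc aᴴ, (ha j).2, hAh.1.eq, mul_assoc,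
        posPt_mul_negPt, mul_zero]
    rw [mul_assoc (K i), h1, mul_assoc (K i), mul_assoc (p * _), ← mul_assoc aᴴ, h2, zero_mul,
      mul_zero, mul_zero]
  have h1 := traceNorm_eq_of_mul_eq_zero (kraus_posSemidef hE hAh) (kraus_posSemidef hE hBh) h0
  rw [← map_sub, posPt_sub_negPt hX, trace_kraus hE hK, trace_kraus hE hK] at h1
  rw [h1, traceNorm_isHermitian hX]

/-- `F` is the trace-preserving conditional expectation onto the algebra `M` with unit `p`. -/
structure IsTraceExpectation (M : NonUnitalStarSubalgebra ℂ (Matrix (Fin d) (Fin d) ℂ))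
    (p : Matrix (Fin d) (Fin d) ℂ) (F : Matrix (Fin d) (Fin d) ℂ →ₗ[ℂ] Matrix (Fin d) (Fin d) ℂ) :
    Prop where
  mem : ∀ X, F X ∈ M
  trace_mul : ∀ X, ∀ m ∈ M, (F X * m).trace = (X * m).trace
  unit_mem : p ∈ M
  unit_isHermitian : p.IsHermitian
  mul_unit : ∀ m ∈ M, m * p = m

/-- The trace form is nondegenerate on `M` because `M` is closed under adjoints: test against the
adjoint of the difference. -/
theorem eq_of_trace_mul_eq {M : NonUnitalStarSubalgebra ℂ (Matrix (Fin d) (Fin d) ℂ)}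
    {X Y : Matrix (Fin d) (Fin d) ℂ} (hX : X ∈ M) (hY : Y ∈ M)
    (h : ∀ m ∈ M, (X * m).trace = (Y * m).trace) : X = Y := by
  have hXY : X - Y ∈ M := sub_mem hX hY
  have h1 := h _ (star_mem hXY)
  rw [← sub_eq_zero, ← Matrix.trace_sub, ← sub_mul, Matrix.star_eq_conjTranspose,
    Matrix.trace_mul_conjTranspose_self_eq_zero_iff] at h1
  exact sub_eq_zero.1 h1

/-- `X` induces a functional on `M`, and nondegeneracy with finite dimension represents it by a
unique element of `M`. -/
theorem exists_trace_expectation (M : NonUnitalStarSubalgebra ℂ (Matrix (Fin d) (Fin d) ℂ)) :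
    ∃ F : Matrix (Fin d) (Fin d) ℂ →ₗ[ℂ] Matrix (Fin d) (Fin d) ℂ, (∀ X, F X ∈ M) ∧
      ∀ X, ∀ m ∈ M, (F X * m).trace = (X * m).trace := by
  set N := M.toSubmodule with hN
  let T : Matrix (Fin d) (Fin d) ℂ →ₗ[ℂ] Module.Dual ℂ N :=
    { toFun := fun X =>
        { toFun := fun m => (X * (m : Matrix (Fin d) (Fin d) ℂ)).trace
          map_add' := fun m m' => by simp [mul_add]
          map_smul' := fun c m => by simp }
      map_add' := fun X Y => by ext m; simp [add_mul]
      map_smul' := fun c X => by ext m; simp }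
  have hT : ∀ X (m : N), T X m = (X * (m : Matrix (Fin d) (Fin d) ℂ)).trace := fun _ _ => rfl
  have hinj : Function.Injective (T ∘ₗ N.subtype) := by
    intro m m' h
    refine Subtype.ext (eq_of_trace_mul_eq (M := M) m.2 m'.2 fun a ha => ?_)
    exact congrArg (fun φ : Module.Dual ℂ N => φ ⟨a, ha⟩) h
  let e := (T ∘ₗ N.subtype).linearEquivOfInjective hinj Subspace.dual_finrank_eq.symm
  refine ⟨N.subtype ∘ₗ e.symm.toLinearMap ∘ₗ T, fun X => (e.symm (T X)).2, fun X m hm => ?_⟩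
  have h1 : e (e.symm (T X)) = T X := e.apply_symm_apply _
  exact congrArg (fun φ : Module.Dual ℂ N => φ ⟨m, hm⟩) h1

namespace IsTraceExpectation

variable {M : NonUnitalStarSubalgebra ℂ (Matrix (Fin d) (Fin d) ℂ)}
  {p X : Matrix (Fin d) (Fin d) ℂ} {F : Matrix (Fin d) (Fin d) ℂ →ₗ[ℂ] Matrix (Fin d) (Fin d) ℂ}

theorem unit_mul_self (h : IsTraceExpectation M p F) : p * p = p := h.mul_unit p h.unit_mem

theorem isHermitian (h : IsTraceExpectation M p F) (hX : X.IsHermitian) : (F X).IsHermitian := by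
  refine eq_of_trace_mul_eq (M := M) (star_mem (h.mem X)) (h.mem X) fun m hm => ?_
  have h1 := congrArg star (h.trace_mul X (star m) (star_mem hm))
  rw [← Matrix.trace_conjTranspose, ← Matrix.trace_conjTranspose, Matrix.conjTranspose_mul,
    Matrix.conjTranspose_mul, hX.eq, Matrix.star_eq_conjTranspose,
    Matrix.conjTranspose_conjTranspose, Matrix.trace_mul_comm, Matrix.trace_mul_comm m X] at h1
  rw [h.trace_mul X m hm]
  exact h1

/-- The negative part `N` of `F X` lies in `M`, so `0 ≤ Tr(X N) = Tr(F X N) = -Tr(N²)`. -/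
theorem posSemidef (h : IsTraceExpectation M p F) (hX : X.PosSemidef) : (F X).PosSemidef := by
  have hY := h.isHermitian hX.1
  have hN : negPt (F X) ∈ M := cfc_mem_algebra _ hY (h.mem X) (by simp)
  have h1 := h.trace_mul X _ hN
  have h2 := trace_mul_re_nonneg hX (negPt_posSemidef (A := F X))
  have h3 := trace_mul_re_nonneg (negPt_posSemidef (A := F X)) (negPt_posSemidef (A := F X))
  have h4 : F X * negPt (F X) = -(negPt (F X) * negPt (F X)) := by
    conv_lhs => lhs; rw [← posPt_sub_negPt hY]
    rw [sub_mul, posPt_mul_negPt, zero_sub]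
  rw [← h1, h4, Matrix.trace_neg, Complex.neg_re] at h2
  have h5 := mul_eq_zero_of_trace (negPt_posSemidef (A := F X)) (negPt_posSemidef (A := F X))
    (by linarith)
  have h6 : negPt (F X) = 0 := by
    rw [← Matrix.conjTranspose_mul_self_eq_zero, negPt_posSemidef.1.eq, h5]
  have h7 := posPt_sub_negPt hY
  rw [h6, sub_zero] at h7
  rw [← h7]; exact posPt_posSemidef

theorem trace_eq (h : IsTraceExpectation M p F) (X : Matrix (Fin d) (Fin d) ℂ) :
    (F X).trace = (X * p).trace := by
  rw [← h.trace_mul X p h.unit_mem, h.mul_unit _ (h.mem X)]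

/-- `F` is positive and, as `p ≤ 1`, does not increase the trace of nonnegative matrices. -/
theorem traceNorm_le (h : IsTraceExpectation M p F) (hX : X.IsHermitian) :
    traceNorm (F X) ≤ traceNorm X := by
  have key : ∀ Y : Matrix (Fin d) (Fin d) ℂ, Y.PosSemidef → (F Y).trace.re ≤ Y.trace.re := by
    intro Y hY
    have h1 := trace_mul_re_nonneg hY (posSemidef_one_sub h.unit_isHermitian h.unit_mul_self)
    rw [mul_sub, mul_one, Matrix.trace_sub, Complex.sub_re] at h1
    rw [h.trace_eq]; linarith
  conv_lhs => rw [← posPt_sub_negPt hX, map_sub]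
  refine (traceNorm_sub_le (h.posSemidef posPt_posSemidef) (h.posSemidef negPt_posSemidef)).trans ?_
  rw [traceNorm_isHermitian hX]
  exact add_le_add (key _ posPt_posSemidef) (key _ negPt_posSemidef)

/-- The optimal test for `X` belongs to `M`, so it has the same bias on `F X`. -/
theorem traceNorm_eq_of_posProj_mem (h : IsTraceExpectation M p F) (hX : X.IsHermitian)
    (hpX : X * p = X) (hP : posProj X ∈ M) : traceNorm (F X) = traceNorm X := by
  refine le_antisymm (h.traceNorm_le hX) ?_
  have h1 := two_mul_trace_le_traceNorm (h.isHermitian hX)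
    (posSemidef_of_isHermitian_mul_self (A := posProj X) posProj_isHermitian posProj_mul_self)
    (posSemidef_one_sub posProj_isHermitian posProj_mul_self)
  rwa [h.trace_mul X _ hP, h.trace_eq, hpX, ← traceNorm_eq_two_mul hX] at h1

end IsTraceExpectation

/-- A preserved code is isometric to a set of states of an algebra whose states form a preserved
code. -/
theorem IsPreservedCode.exists_isTraceExpectation {C : Set (Matrix (Fin d) (Fin d) ℂ)}
    (hE : ∀ ρ, E ρ = ∑ i, K i * ρ * (K i)ᴴ) (hK : ∑ i, (K i)ᴴ * K i = 1)
    (hC : IsPreservedCode E C) :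
    ∃ (M : NonUnitalStarSubalgebra ℂ (Matrix (Fin d) (Fin d) ℂ)) (p : Matrix (Fin d) (Fin d) ℂ)
      (F : Matrix (Fin d) (Fin d) ℂ →ₗ[ℂ] Matrix (Fin d) (Fin d) ℂ),
      IsTraceExpectation M p F ∧ IsPreservedCode E (algebraStates M) ∧
      (∀ ρ ∈ C, F ρ ∈ algebraStates M) ∧
      ∀ ρ ∈ C, ∀ σ ∈ C, ∀ x : ℝ, traceNorm (F ρ - (x : ℂ) • F σ) = traceNorm (ρ - (x : ℂ) • σ) := by
  obtain ⟨p, hp⟩ := exists_isCodeSupport fun ρ hρ => (hC.1 hρ).1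
  set M := krausAlgebra K hp.isHermitian with hM
  obtain ⟨F, hFM, hFt⟩ := exists_trace_expectation M
  have hF : IsTraceExpectation M p F :=
    { mem := hFM
      trace_mul := hFt
      unit_mem := ⟨hp.mul_self, hp.mul_self, 1, fun i => by simp [hp.isHermitian.eq]⟩
      unit_isHermitian := hp.isHermitian
      mul_unit := fun m hm => (mem_krausAlgebra.1 hm).2.1 }
  have hCp : ∀ ρ ∈ C, ρ * p = ρ := by
    intro ρ hρ
    have := congrArg Matrix.conjTranspose (hp.mul_eq ρ hρ)
    rwa [Matrix.conjTranspose_mul, hp.isHermitian.eq, (hC.1 hρ).1.1.eq] at this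
  refine ⟨M, p, F, hF, ⟨fun ρ hρ => hρ.2, fun ρ hρ σ hσ x _ => ?_⟩, fun ρ hρ => ?_,
    fun ρ hρ σ hσ x => ?_⟩
  · exact traceNorm_kraus_of_mem hE hK (hρ.2.1.1.sub (isHermitian_ofReal_smul x hσ.2.1.1))
      (sub_mem hρ.1 (SMulMemClass.smul_mem _ hσ.1))
  · exact ⟨hF.mem ρ, hF.posSemidef (hC.1 hρ).1, by rw [hF.trace_eq, hCp ρ hρ, (hC.1 hρ).2]⟩
  · have hρp := (hC.1 hρ).1
    have hσp := (hC.1 hσ).1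
    have h1 := continuous_traceNorm_sub (hF.isHermitian hρp.1) (hF.posSemidef hσp)
    have h2 := continuous_traceNorm_sub hρp.1 hσp
    -- Generic weights put the optimal test in `M`; continuity in the weight covers the remaining
    -- ones.
    refine congrFun (Continuous.ext_on (dense_setOf_mul_suppProj hρp hσp) h1 h2 ?_) x
    rintro y ⟨hy1, hy2⟩
    have hXh := hρp.1.sub (isHermitian_ofReal_smul y hσp.1)
    have hPM : posProj (ρ - (y : ℂ) • σ) ∈ M := by
      obtain ⟨h3, h5⟩ := posProj_mul_kraus hE hK hC hp hρ hσ hy1 hy2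
      have hPh := posProj_isHermitian (A := ρ - (y : ℂ) • σ)
      have hQh := posProj_isHermitian (A := E (ρ - (y : ℂ) • σ))
      refine ⟨h5, ?_, posProj (E (ρ - (y : ℂ) • σ)), fun i => ⟨h3 i, ?_⟩⟩
      · have h6 := congrArg Matrix.conjTranspose h5
        rwa [Matrix.conjTranspose_mul, hPh.eq, hp.isHermitian.eq] at h6
      · rw [hQh.eq, hPh.eq]; exact h3 i
    have h4 := hF.traceNorm_eq_of_posProj_mem hXh
      (by rw [sub_mul, smul_mul_assoc, hCp ρ hρ, hCp σ hσ]) hPM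
    rw [map_sub, map_smul] at h4
    exact h4

end algebra

/-! ### Eigenprojections and the span of the states of an algebra. -/

section spectral

variable {d : ℕ}

/-- The spectral projection of a Hermitian matrix for the eigenvalue `l`. -/
noncomputable def eigProj (A : Matrix (Fin d) (Fin d) ℂ) (l : ℝ) : Matrix (Fin d) (Fin d) ℂ :=
  cfc (fun x : ℝ => if x = l then 1 else 0) A

variable {A B Y : Matrix (Fin d) (Fin d) ℂ}

theorem eigProj_isHermitian (l : ℝ) : (eigProj A l).IsHermitian := isHermitian_cfc _ _

theorem eigProj_mul_self (l : ℝ) : eigProj A l * eigProj A l = eigProj A l := by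
  rw [eigProj, cfc_mul_cfc]
  congr 1; ext x; split_ifs <;> simp

theorem mul_eigProj (hA : A.IsHermitian) (l : ℝ) : A * eigProj A l = (l : ℂ) • eigProj A l := by
  have h : (l : ℂ) • eigProj A l = cfc (fun x : ℝ => l * if x = l then 1 else 0) A := by
    rw [cfc_const_mul l _ A (continuousOn_spectrum A _), eigProj]
    ext i j; simp
  rw [h, eigProj, cfc_mul_self_right hA]
  congr 1; ext x; split_ifs with h <;> simp [h]

theorem eigProj_zero (hA : A.IsHermitian) : eigProj A 0 = 1 - suppProj A := by
  have h := cfc_const_real hA 1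
  rw [Complex.ofReal_one, one_smul] at h
  rw [← h, eigProj, suppProj, cfc_sub_cfc]
  congr 1; ext x; split_ifs <;> simp

theorem suppProj_mem (M : NonUnitalStarSubalgebra ℂ (Matrix (Fin d) (Fin d) ℂ))
    (hA : A.IsHermitian) (hM : A ∈ M) : suppProj A ∈ M := cfc_mem_algebra M hA hM (by simp)

theorem eq_of_mul_eigProj_eq (hA : A.IsHermitian)
    (h : ∀ l, B * eigProj A l = Y * eigProj A l) : B = Y := by
  have h1 : ∑ l ∈ (Matrix.finite_real_spectrum (A := A)).toFinset, eigProj A l = 1 := by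
    have h2 := cfc_const_real hA 1
    rw [Complex.ofReal_one, one_smul] at h2
    rw [← h2]
    unfold eigProj
    rw [← cfc_sum _ A _ fun l _ => continuousOn_spectrum A _]
    refine cfc_congr fun x hx => ?_
    simp [hx]
  rw [← mul_one B, ← mul_one Y, ← h1, Finset.mul_sum, Finset.mul_sum]
  exact Finset.sum_congr rfl fun l _ => h l

/-- Real and imaginary parts, their positive and negative parts, and normalisation by the trace all
stay in `M`. -/
theorem mem_span_algebraStates {M : NonUnitalStarSubalgebra ℂ (Matrix (Fin d) (Fin d) ℂ)}
    (hA : A ∈ M) : A ∈ Submodule.span ℂ (algebraStates M) := by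
  have hpsd : ∀ B : Matrix (Fin d) (Fin d) ℂ, B ∈ M → B.PosSemidef →
      B ∈ Submodule.span ℂ (algebraStates M) := by
    intro B hB hBp
    rcases eq_or_ne B.trace.re 0 with h0 | h0
    · rw [posSemidef_eq_zero_of_trace hBp h0]; exact zero_mem _
    · have him : ((B.trace.re : ℝ) : ℂ) = B.trace :=
        Complex.ext rfl (Complex.nonneg_iff.1 hBp.trace_nonneg).2
      have h1 : B = (B.trace.re : ℂ) • ((B.trace.re⁻¹ : ℝ) : ℂ) • B := by
        rw [smul_smul, ← Complex.ofReal_mul, mul_inv_cancel₀ h0, Complex.ofReal_one, one_smul]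
      rw [h1]
      refine Submodule.smul_mem _ _ (Submodule.subset_span ⟨SMulMemClass.smul_mem _ hB,
        posSemidef_ofReal_smul (inv_nonneg.2 (trace_re_nonneg hBp)) hBp, ?_⟩)
      rw [Matrix.trace_smul, ← him, smul_eq_mul, ← Complex.ofReal_mul, Complex.ofReal_re,
        inv_mul_cancel₀ h0, Complex.ofReal_one]
  have hherm : ∀ B : Matrix (Fin d) (Fin d) ℂ, B ∈ M → B.IsHermitian →
      B ∈ Submodule.span ℂ (algebraStates M) := by
    intro B hB hBh
    rw [← posPt_sub_negPt hBh]
    exact sub_mem (hpsd _ (cfc_mem_algebra M hBh hB (by simp)) posPt_posSemidef)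
      (hpsd _ (cfc_mem_algebra M hBh hB (by simp)) negPt_posSemidef)
  have h1 : A = (2⁻¹ : ℂ) • (A + Aᴴ) - (2⁻¹ * Complex.I) • (Complex.I • (A - Aᴴ)) := by
    rw [smul_smul, mul_assoc, Complex.I_mul_I]
    module
  have hAs : Aᴴ ∈ M := star_mem hA
  rw [h1]
  refine sub_mem (Submodule.smul_mem _ _ (hherm _ (add_mem hA hAs) ?_))
    (Submodule.smul_mem _ _ (hherm _ (SMulMemClass.smul_mem _ (sub_mem hA hAs)) ?_))
  · rw [Matrix.IsHermitian, Matrix.conjTranspose_add, Matrix.conjTranspose_conjTranspose, add_comm]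
  · rw [Matrix.IsHermitian, Matrix.conjTranspose_smul, Matrix.conjTranspose_sub,
      Matrix.conjTranspose_conjTranspose]
    simp only [Complex.star_def, Complex.conj_I]
    module

end spectral

/-! ### Rigidity: codes mapped by `F` onto all states of an algebra. -/

section rigidity

variable {d : ℕ} {M : NonUnitalStarSubalgebra ℂ (Matrix (Fin d) (Fin d) ℂ)}
  {p : Matrix (Fin d) (Fin d) ℂ} {F : Matrix (Fin d) (Fin d) ℂ →ₗ[ℂ] Matrix (Fin d) (Fin d) ℂ}
  {C : Set (Matrix (Fin d) (Fin d) ℂ)}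

/-- A state of the code restricted to an eigenprojection of its image in the algebra. -/
theorem IsTraceExpectation.mul_proj_eq (hF : IsTraceExpectation M p F)
    (hC : C ⊆ densityMatrices d)
    (hFC : ∀ ρ ∈ C, F ρ ∈ algebraStates M)
    (hiso : ∀ ρ ∈ C, ∀ σ ∈ C, ∀ x : ℝ,
      traceNorm (F ρ - (x : ℂ) • F σ) = traceNorm (ρ - (x : ℂ) • σ))
    {ρ g q : Matrix (Fin d) (Fin d) ℂ} (hρ : ρ ∈ C) (hg : g ∈ C) (hqM : q ∈ M)
    (hqh : q.IsHermitian) (hqq : q * q = q) {τ l : ℝ} (hτ : 0 < τ) (hqt : q.trace = τ)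
    (hFg : F g = ((τ⁻¹ : ℝ) : ℂ) • q) (hl : F ρ * q = (l : ℂ) • q) :
    ρ * q = ((l * τ : ℝ) : ℂ) • g ∧ q * ρ = ((l * τ : ℝ) : ℂ) • g := by
  have hρp := (hC hρ).1
  have hgp := (hC hg).1
  have hm := (hFC ρ hρ).2
  have hl' : q * F ρ = (l : ℂ) • q := by
    have := congrArg Matrix.conjTranspose hl
    rw [Matrix.conjTranspose_mul, Matrix.conjTranspose_smul, hqh.eq, hm.1.1.eq] at this
    simpa using this
  have hsub : F ρ - ((l * τ : ℝ) : ℂ) • F g = F ρ - (l : ℂ) • q := by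
    rw [hFg, smul_smul, ← Complex.ofReal_mul, mul_assoc, mul_inv_cancel₀ hτ.ne', mul_one]
  have hpsd : (F ρ - (l : ℂ) • q).PosSemidef := by
    have h1 := hm.1.conjTranspose_mul_mul_same (1 - q)
    rw [(Matrix.isHermitian_one.sub hqh).eq] at h1
    convert h1 using 1
    simp only [mul_sub, sub_mul, one_mul, mul_one, hl, hl', smul_mul_assoc, hqq]
    abel
  -- The isometry transfers positivity from the algebra back to the code, since the traces agree.
  have hpsd' : (ρ - ((l * τ : ℝ) : ℂ) • g).PosSemidef := by
    refine posSemidef_of_traceNorm_eq (hρp.1.sub (isHermitian_ofReal_smul _ hgp.1)) ?_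
    have h2 := traceNorm_of_posSemidef hpsd
    rw [← hsub, hiso ρ hρ g hg, Matrix.trace_sub, Matrix.trace_smul, hm.2, (hFC g hg).2.2] at h2
    rw [h2, Matrix.trace_sub, Matrix.trace_smul, (hC hρ).2, (hC hg).2]
  have hqp : q.PosSemidef := posSemidef_of_isHermitian_mul_self hqh hqq
  -- All the weight of `g` lies on `q`, because `Tr(g q) = Tr(F g q) = 1`.
  have hgq : g * q = g := by
    have h1 : (g * (1 - q)).trace.re = 0 := by
      rw [mul_sub, mul_one, Matrix.trace_sub, ← hF.trace_mul g q hqM, hFg, smul_mul_assoc, hqq,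
        Matrix.trace_smul, hqt, (hC hg).2, smul_eq_mul, ← Complex.ofReal_mul,
        inv_mul_cancel₀ hτ.ne']
      simp
    have h2 := mul_eq_zero_of_trace hgp (posSemidef_one_sub hqh hqq) h1
    rw [mul_sub, mul_one, sub_eq_zero] at h2
    exact h2.symm
  have h0 : ((ρ - ((l * τ : ℝ) : ℂ) • g) * q).trace.re = 0 := by
    rw [sub_mul, smul_mul_assoc, hgq, Matrix.trace_sub, ← hF.trace_mul ρ q hqM, hl,
      Matrix.trace_smul, Matrix.trace_smul, hqt, (hC hg).2]
    simp
  have h1 := mul_eq_zero_of_trace hpsd' hqp h0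
  rw [sub_mul, smul_mul_assoc, hgq, sub_eq_zero] at h1
  refine ⟨h1, ?_⟩
  have h2 := congrArg Matrix.conjTranspose h1
  rw [Matrix.conjTranspose_mul, hqh.eq, hρp.1.eq, (isHermitian_ofReal_smul _ hgp.1).eq] at h2
  exact h2

/-- A code isometric, through a conditional expectation, to the full state space of an algebra
consists of the states of the algebra multiplied by a fixed operator of the commutant. -/
theorem IsTraceExpectation.exists_commutant (hF : IsTraceExpectation M p F)
    (hC : C ⊆ densityMatrices d) (hFC : F '' C = algebraStates M)
    (hiso : ∀ ρ ∈ C, ∀ σ ∈ C, ∀ x : ℝ,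
      traceNorm (F ρ - (x : ℂ) • F σ) = traceNorm (ρ - (x : ℂ) • σ)) :
    ∃ t : Matrix (Fin d) (Fin d) ℂ, t.PosSemidef ∧ F t = p ∧
      (∀ m ∈ M, m.IsHermitian → t * m = m * t) ∧ ∀ ρ ∈ C, F ρ * t = ρ := by
  have hFC' : ∀ ρ ∈ C, F ρ ∈ algebraStates M := fun ρ hρ => hFC ▸ Set.mem_image_of_mem F hρ
  have hpp : p.PosSemidef := posSemidef_of_isHermitian_mul_self hF.unit_isHermitian hF.unit_mul_self
  have htrace : ∀ q : Matrix (Fin d) (Fin d) ℂ, q.PosSemidef → q ≠ 0 →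
      0 < q.trace.re ∧ q.trace = (q.trace.re : ℝ) := fun q hq h0 =>
    ⟨(trace_re_nonneg hq).lt_of_ne fun h => h0 (posSemidef_eq_zero_of_trace hq h.symm),
      Complex.ext rfl (Complex.nonneg_iff.1 hq.trace_nonneg).2.symm⟩
  have hlift : ∀ q ∈ M, q.PosSemidef → q ≠ 0 → ∃ g ∈ C, F g = ((q.trace.re⁻¹ : ℝ) : ℂ) • q := by
    intro q hq hqp h0
    obtain ⟨h1, h2⟩ := htrace q hqp h0
    have h3 : ((q.trace.re⁻¹ : ℝ) : ℂ) • q ∈ algebraStates M := by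
      refine ⟨SMulMemClass.smul_mem _ hq, posSemidef_ofReal_smul (inv_nonneg.2 h1.le) hqp, ?_⟩
      rw [Matrix.trace_smul, h2, smul_eq_mul, ← Complex.ofReal_mul, Complex.ofReal_re,
        inv_mul_cancel₀ h1.ne', Complex.ofReal_one]
    rw [← hFC] at h3
    exact h3
  -- If `p = 0` the algebra is zero and has no states, so `C` is empty.
  rcases eq_or_ne p 0 with hp0 | hp0
  · refine ⟨0, Matrix.PosSemidef.zero, by rw [map_zero, hp0], fun m _ _ => by simp,
      fun ρ hρ => ?_⟩
    have h1 := (hFC' ρ hρ).2.2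
    rw [← hF.mul_unit _ (hF.mem ρ), hp0, mul_zero, Matrix.trace_zero] at h1
    exact absurd h1 zero_ne_one
  obtain ⟨hD, -⟩ := htrace p hpp hp0
  -- The code state lying over the maximally mixed state of `M`; rescaled to `D ρ₀`, it is the
  -- operator `t`.
  obtain ⟨ρ₀, hρ₀, hFρ₀⟩ := hlift p hF.unit_mem hpp hp0
  set D := p.trace.re
  have hpm : ∀ m ∈ M, m.IsHermitian → p * m = m := by
    intro m hm hmh
    have := congrArg Matrix.conjTranspose (hF.mul_unit m hm)
    rwa [Matrix.conjTranspose_mul, hmh.eq, hF.unit_isHermitian.eq] at this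
  have hDD : (D : ℂ) * ((D⁻¹ : ℝ) : ℂ) = 1 := by
    rw [← Complex.ofReal_mul, mul_inv_cancel₀ hD.ne', Complex.ofReal_one]
  have hproj : ∀ q ∈ M, q.IsHermitian → q * q = q → ((D : ℂ) • ρ₀) * q = q * ((D : ℂ) • ρ₀) ∧
      ∀ ρ ∈ C, ∀ l : ℝ, F ρ * q = (l : ℂ) • q → ρ * q = (D : ℂ) • ρ₀ * F ρ * q := by
    intro q hq hqh hqq
    rcases eq_or_ne q 0 with h0 | h0
    · simp [h0]
    have hqp := posSemidef_of_isHermitian_mul_self hqh hqq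
    obtain ⟨hτ, hqt⟩ := htrace q hqp h0
    obtain ⟨g, hg, hFg⟩ := hlift q hq hqp h0
    have h1 := hF.mul_proj_eq hC hFC' hiso hρ₀ hg hq hqh hqq hτ hqt hFg (l := D⁻¹)
      (by rw [hFρ₀, smul_mul_assoc, hpm q hq hqh])
    refine ⟨by rw [smul_mul_assoc, mul_smul_comm, h1.1, h1.2], fun ρ hρ l hl => ?_⟩
    -- On `q`, both `ρ` and `ρ₀` are multiples of the same `g`, which can then be eliminated.
    have h2 := hF.mul_proj_eq hC hFC' hiso hρ hg hq hqh hqq hτ hqt hFg hl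
    rw [h2.1, mul_assoc, hl, smul_mul_assoc, mul_smul_comm, h1.1, smul_smul, smul_smul,
      Complex.ofReal_mul, Complex.ofReal_mul]
    congr 1
    linear_combination (-(l : ℂ) * (q.trace.re : ℂ)) * hDD
  have htp : ((D : ℂ) • ρ₀).PosSemidef := posSemidef_ofReal_smul hD.le (hC hρ₀).1
  set t := (D : ℂ) • ρ₀ with ht
  have heig : ∀ m ∈ M, m.IsHermitian → ∀ l : ℝ, l ≠ 0 → eigProj m l ∈ M := fun m hm hmh l hl =>
    cfc_mem_algebra M hmh hm (by simp [hl.symm])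
  have hcomm : ∀ m ∈ M, m.IsHermitian → t * m = m * t := by
    intro m hm hmh
    refine eq_of_mul_eigProj_eq hmh fun l => ?_
    -- The eigenprojection for `0` need not lie in `M`; its complement, the support projection,
    -- does.
    rcases eq_or_ne l 0 with rfl | hl
    · have h1 := (hproj _ (suppProj_mem M hmh hm) suppProj_isHermitian suppProj_mul_self).1
      rw [mul_assoc, mul_eigProj hmh, eigProj_zero hmh, mul_assoc, mul_sub t, h1, mul_one, mul_sub,
        ← mul_assoc, mul_suppProj hmh, sub_self]
      simp
    · have h1 := (hproj _ (heig m hm hmh l hl) (eigProj_isHermitian l) (eigProj_mul_self l)).1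
      rw [mul_assoc, mul_eigProj hmh, mul_smul_comm, mul_assoc, h1, ← mul_assoc, mul_eigProj hmh,
        smul_mul_assoc]
  refine ⟨t, htp, ?_, hcomm, fun ρ hρ => ?_⟩
  · rw [ht, map_smul, hFρ₀, smul_smul, hDD, one_smul]
  · have hm := hFC' ρ hρ
    rw [← hcomm _ hm.1 hm.2.1.1]
    refine (eq_of_mul_eigProj_eq hm.2.1.1 fun l => ?_).symm
    rcases eq_or_ne l 0 with rfl | hl
    · have h1 : (ρ * (1 - suppProj (F ρ))).trace.re = 0 := by
        rw [mul_sub, mul_one, Matrix.trace_sub, ← hF.trace_mul ρ _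
          (suppProj_mem M hm.2.1.1 hm.1), mul_suppProj hm.2.1.1, hm.2.2, (hC hρ).2]
        simp
      have h2 := mul_eq_zero_of_trace (hC hρ).1
        (posSemidef_one_sub suppProj_isHermitian suppProj_mul_self) h1
      rw [mul_assoc, mul_eigProj hm.2.1.1, eigProj_zero hm.2.1.1, h2]
      simp
    · exact (hproj _ (heig _ hm.1 hm.2.1.1 l hl) (eigProj_isHermitian l) (eigProj_mul_self l)).2 ρ hρ
        l (mul_eigProj hm.2.1.1 l)

/-- Multiplying the elements of an algebra by an operator of its commutant preserves the trace
norm, if that operator is nonnegative and has the unit as its conditional expectation. -/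
theorem IsTraceExpectation.traceNorm_mul (hF : IsTraceExpectation M p F)
    {t : Matrix (Fin d) (Fin d) ℂ} (ht : t.PosSemidef) (hFt : F t = p)
    (hcomm : ∀ m ∈ M, m.IsHermitian → t * m = m * t) {m : Matrix (Fin d) (Fin d) ℂ} (hm : m ∈ M) :
    traceNorm (m * t) = traceNorm m := by
  have hA := Matrix.posSemidef_conjTranspose_mul_self m
  have hAM : mᴴ * m ∈ M := mul_mem (star_mem hm) hm
  -- `h` is the square root of `|m|`. As it commutes with `t`, `h t h = |m| t` is visibly
  -- nonnegative and is the absolute value of `m t`.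
  set h := cfc (fun x : ℝ => Real.sqrt (Real.sqrt x)) (mᴴ * m) with hh
  have hhM : h ∈ M := cfc_mem_algebra M hA.1 hAM (by simp)
  have hhh : h.IsHermitian := isHermitian_cfc _ _
  have hh4 : h * h * (h * h) = mᴴ * m := by
    conv_rhs => rw [← cfc_self hA.1]
    rw [hh, cfc_mul_cfc, cfc_mul_cfc]
    refine cfc_congr fun x hx => ?_
    have hx0 : 0 ≤ x := by
      simpa using (Matrix.posSemidef_iff_isHermitian_and_spectrum_nonneg.1 hA).2 hx
    simp only [Real.mul_self_sqrt (Real.sqrt_nonneg x), Real.mul_self_sqrt hx0]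
  have hth := hcomm h hhM hhh
  have hhp : (h * h).PosSemidef := by
    have := Matrix.posSemidef_conjTranspose_mul_self h
    rwa [hhh.eq] at this
  have hBp : (h * t * h).PosSemidef := by
    have := ht.conjTranspose_mul_mul_same h
    rwa [hhh.eq] at this
  have hB : h * t * h = h * h * t := by rw [mul_assoc, hth, mul_assoc]
  have hhht : t * (h * h) = h * h * t := by rw [← mul_assoc, hth, mul_assoc, hth, mul_assoc]
  rw [traceNorm_eq_trace hBp, traceNorm_eq_trace hhp (by rw [hh4]), hB, ← hhht,
    ← hF.trace_mul t _ (mul_mem hhM hhM), hFt, Matrix.trace_mul_comm, hF.mul_unit _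
    (mul_mem hhM hhM)]
  rw [hB, Matrix.conjTranspose_mul, ht.1.eq]
  calc h * h * t * (h * h * t) = t * (h * h * (h * h)) * t := by
        rw [← hhht]; simp only [mul_assoc]; rw [hhht]; simp only [mul_assoc]
    _ = t * mᴴ * (m * t) := by rw [hh4]; simp only [mul_assoc]

theorem IsTraceExpectation.isometricToAlgebra (hF : IsTraceExpectation M p F)
    (hC : C ⊆ densityMatrices d) (hFC : F '' C = algebraStates M)
    (hiso : ∀ ρ ∈ C, ∀ σ ∈ C, ∀ x : ℝ,
      traceNorm (F ρ - (x : ℂ) • F σ) = traceNorm (ρ - (x : ℂ) • σ)) :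
    IsometricToAlgebra C M := by
  obtain ⟨t, htp, hFt, hcomm, hCt⟩ := hF.exists_commutant hC hFC hiso
  have hspan : ∀ X ∈ Submodule.span ℂ C, F X * t = X := by
    intro X hX
    induction hX using Submodule.span_induction with
    | mem x hx => exact hCt x hx
    | zero => simp
    | add x y _ _ hx hy => rw [map_add, add_mul, hx, hy]
    | smul a x _ hx => rw [map_smul, smul_mul_assoc, hx]
  let Ψ : Submodule.span ℂ C →ₗ[ℂ] M.toSubmodule :=
    (F ∘ₗ (Submodule.span ℂ C).subtype).codRestrict M.toSubmodule fun X => hF.mem X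
  have hbij : Function.Bijective Ψ := by
    constructor
    · intro X Y h
      have h1 : F X = F Y := congrArg Subtype.val h
      exact Subtype.ext (by rw [← hspan X X.2, ← hspan Y Y.2, h1])
    · intro m
      have h1 : (m : Matrix (Fin d) (Fin d) ℂ) ∈ Submodule.map F (Submodule.span ℂ C) := by
        rw [Submodule.map_span, hFC]
        exact mem_span_algebraStates m.2
      obtain ⟨X, hX, hXm⟩ := h1
      exact ⟨⟨X, hX⟩, Subtype.ext hXm⟩
  refine ⟨LinearEquiv.ofBijective Ψ hbij, fun X => ?_, fun X => ⟨fun hX => ?_, fun hX => ?_⟩⟩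
  · change traceNorm (F X) = traceNorm (X : Matrix (Fin d) (Fin d) ℂ)
    rw [← hF.traceNorm_mul htp hFt hcomm (hF.mem X), hspan X X.2]
  · change F X ∈ algebraStates M
    exact hFC ▸ Set.mem_image_of_mem F hX
  · replace hX : F X ∈ algebraStates M := hX
    rw [← hFC] at hX
    obtain ⟨ρ, hρ, h⟩ := hX
    rw [← hspan X X.2, ← h, hCt ρ hρ]
    exact hρ

end rigidity

/-! ### Optimality and conclusion. -/

/-- If `F` missed a state of `M`, the code would be isometric to a proper subset of the preserved
code formed by the states of `M`. The same `M` serves both notions of isometry. -/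
theorem IsOptimalPreservedCode.exists_algebra {d : ℕ}
    {E : Matrix (Fin d) (Fin d) ℂ →ₗ[ℂ] Matrix (Fin d) (Fin d) ℂ} (hE : IsQuantumProcess E)
    {C : Set (Matrix (Fin d) (Fin d) ℂ)} (hC : IsOptimalPreservedCode E C) :
    ∃ A : NonUnitalStarSubalgebra ℂ (Matrix (Fin d) (Fin d) ℂ),
      IsometricToAlgebra C A ∧ IsometricCodes C (algebraStates A) := by
  obtain ⟨n, K, hEK, hK⟩ := hE
  obtain ⟨M, p, F, hF, hM, hFC, hiso⟩ := hC.1.exists_isTraceExpectation hEK hK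
  have hinj : Set.InjOn F C := by
    intro ρ hρ σ hσ h
    have h1 := hiso ρ hρ σ hσ 1
    rw [h, Complex.ofReal_one, one_smul, one_smul, sub_self,
      traceNorm_of_posSemidef Matrix.PosSemidef.zero, Matrix.trace_zero, Complex.zero_re] at h1
    exact sub_eq_zero.1 (eq_zero_of_traceNorm ((hC.1.1 hρ).1.1.sub (hC.1.1 hσ).1.1) h1.symm)
  have hsub : F '' C ⊆ algebraStates M := Set.image_subset_iff.2 hFC
  have himg : F '' C = algebraStates M := by
    by_contra hne
    exact hC.2 _ _ hM (hsub.ssubset_of_ne hne)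
      ⟨F, hinj.bijOn_image, fun ρ hρ σ hσ x _ => hiso ρ hρ σ hσ x⟩
  exact ⟨M, hF.isometricToAlgebra hC.1.1 himg hiso, F, himg ▸ hinj.bijOn_image,
    fun ρ hρ σ hσ x _ => hiso ρ hρ σ hσ x⟩

theorem IsometricCodes.trans {d : ℕ} {C C' C'' : Set (Matrix (Fin d) (Fin d) ℂ)}
    (h : IsometricCodes C C') (h' : IsometricCodes C' C'') : IsometricCodes C C'' := by
  obtain ⟨f, hf, hfn⟩ := h
  obtain ⟨g, hg, hgn⟩ := h'
  refine ⟨g ∘ f, hg.comp hf, fun ρ hρ σ hσ x hx => ?_⟩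
  rw [← hfn ρ hρ σ hσ x hx]
  exact hgn _ (hf.mapsTo hρ) _ (hf.mapsTo hσ) x hx

theorem mainTheorem4 (d : ℕ)
    (E : Matrix (Fin d) (Fin d) ℂ →ₗ[ℂ] Matrix (Fin d) (Fin d) ℂ) (hE : IsQuantumProcess E) :
    (∀ C : Set (Matrix (Fin d) (Fin d) ℂ), IsOptimalPreservedCode E C →
      ∃ A : NonUnitalStarSubalgebra ℂ (Matrix (Fin d) (Fin d) ℂ), IsometricToAlgebra C A) ∧
    (∀ I : Set (Set (Matrix (Fin d) (Fin d) ℂ)), IsIPS E I →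
      ∃ A : NonUnitalStarSubalgebra ℂ (Matrix (Fin d) (Fin d) ℂ),
        ∀ C ∈ I, IsometricCodes C (algebraStates A)) := by
  refine ⟨fun C hC => ?_, ?_⟩
  · obtain ⟨A, hA, -⟩ := hC.exists_algebra hE
    exact ⟨A, hA⟩
  · rintro I ⟨C₀, hC₀, rfl⟩
    obtain ⟨A, -, hA⟩ := hC₀.exists_algebra hE
    exact ⟨A, fun C hC => hC.2.trans hA⟩
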